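/- Fix $0<\varepsilon<1$. For $k\ge 1$ put $\delta_k=\pi/2^{k+1}$. For $0<r<R$ let $Z_k(r,R)\subset\mathbb R^2$ be the closed polygonal curve with consecutive vertices $Re^{2ji\delta_k},\ re^{(2j+1)i\delta_k}$, $j=0,\dots,2^{k+1}-1$ (so it has $2^{k+1}$ outer vertices), and let the ribbon $\omega_k$ be the open region between the outer boundary curve $Z_k(1,2)$ and the inner boundary curve $Z_k(1-\varepsilon,2-\varepsilon)$. Write $\partial_\alpha=t_2\partial_{t_3}-t_3\partial_{t_2}$ for the angular derivative. Let $\beta_0>0$ and let $\mu\ge0$ be an absolutely continuous function on $\mathbb R$ with $\dot\mu\in L^1(\mathbb R)$ and support in $[-s_0,s_0]$ for some $s_0>0$. Let $d_k=\sup_{t\in\omega_k}|t|$, $\gamma=\min\{\frac13,\frac1{48\beta_0^2d_k^2}\}$, assume $\|\mu\|_\infty<c\beta_0$ for some $c\in(0,\frac13\gamma)$, and put $\alpha=\sqrt{\gamma-3c}$. Let $h_k$ be the self-adjoint operator on $L^2(\omega_k)$ associated with the closure of the form $\int_{\omega_k}(|\nabla u|^2+\beta_0^2|\partial_\alpha u|^2)\,dt$,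 $u\in C_0^\infty(\omega_k)$, i.e. $h_k=-\Delta_D^{\omega_k}-\beta_0^2\partial_\alpha^2$. Let $E_k=\inf\sigma(h_k)$ and let $f_k\in H_0^1(\omega_k)$ be its ground-state eigenfunction, which is strictly positive and $C^2$ in $\omega_k$ (positivity and smoothness make the following operator meaningful). For $s\in\mathbb R$ consider the operator $$H_k(s)=-\Delta_D^{\omega_k}-\beta_0^2\partial_\alpha^2-\frac1{\alpha^2}\Big(\dot\mu(s)\frac{\partial_\alpha f_k}{f_k}-\mu(s)(2\beta_0-\mu(s))\frac{\partial_\alpha^2f_k}{f_k}\Big)-E_k,$$ understood through its quadratic form on $C_0^\infty(\omega_k)$. Let $\lambda_{1,k}(s)=\inf\{\langle u,H_k(s)u\rangle: u\in C_0^\infty(\omega_k),\ \|u\|=1\}\in[-\infty,\infty)$ be its ground-state eigenvalue, and let $\mathrm{tr}\,H_k(s)_-^{p}=\sum_n(\lambda_{n,k}(s))_-^p\in[0,\infty]$, where $\lambda_{n,k}(s)$ are the minimax values of the form, counted with multiplicity. Then: (a) Each $\omega_k$ is open, bounded, connected and not rotationally symmetric with respect to the origin; $d_k=2$ (so $\gamma$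 and $\alpha$ do not depend on $k$), and $\omega_k$ has diameter at most $4$ and area at most $4\pi$. (b) For all $k\ge1$ and $s\in\mathbb R$, $$\lambda_{1,k}(s)\le-\frac{4^{k+1}}{\pi^2}\,\frac{\mu(s)(2\beta_0-\mu(s))}{\alpha^2},$$ and the inequality is strict whenever $\mu(s)>0$; in particular, $|\lambda_{1,k}(s)|>\frac{4^{k+1}}{\pi^2}\frac{\mu(s)(2\beta_0-\mu(s))}{\alpha^2}$ for every $s$ with $\mu(s)>0$. (c) For all $\sigma\ge\frac32$ and $k\ge1$ the right-hand side of the Lieb–Thirring estimate satisfies $$\alpha^{2\sigma}L^{\rm cl}_{\sigma,1}\int_{\mathbb R}\mathrm{tr}\,H_k(s)_-^{\sigma+1/2}\,ds\ \ge\ \frac1\alpha\Big(\frac{4^{k+1}}{\pi^2}\Big)^{\sigma+1/2}\int_{\mathbb R}\mu(s)^{\sigma+1/2}(2\beta_0-\mu(s))^{\sigma+1/2}\,ds,\qquad L^{\rm cl}_{\sigma,1}=\frac{\Gamma(\sigma+1)}{\sqrt{4\pi}\,\Gamma(\sigma+\frac32)}.$$ Hence, if $\mu\not\equiv0$, it tends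 to $\infty$ as $k\to\infty$, although the diameters and areas of the $\omega_k$ stay bounded. -/

import Mathlib

open Set Filter Topology MeasureTheory
open scoped ENNReal

/-! The normal plane `ℝ²` with coordinates `(t₂, t₃)` is identified with `ℂ` through
`z = t₂ + i t₃` (same Euclidean norm, same Lebesgue measure). -/

noncomputable section

namespace FoldedRibbon

/-! ### The cross sections -/

/-- The `j`-th outer vertex of the zigzag of step `k`: modulus `R`, angle `2 j · π / 2 ^ (k + 1)`.
There are `2 ^ (k + 1)` of them, `j = 0, …, 2 ^ (k + 1) - 1`. -/
def outerVertex (k : ℕ) (R : ℝ) (j : ℕ) : ℂ :=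
  (R : ℂ) * Complex.exp (((2 * j * (Real.pi / 2 ^ (k + 1)) : ℝ) : ℂ) * Complex.I)

/-- The `j`-th inner vertex of the zigzag of step `k`: modulus `r`, angle
`(2 j + 1) · π / 2 ^ (k + 1)`. -/
def innerVertex (k : ℕ) (r : ℝ) (j : ℕ) : ℂ :=
  (r : ℂ) * Complex.exp ((((2 * j + 1) * (Real.pi / 2 ^ (k + 1)) : ℝ) : ℂ) * Complex.I)

/-- The closed piecewise linear zigzag curve whose vertices lie on the `2 ^ (k + 2)` equidistant
rays from the origin, alternately on the circles of radius `R` and `r`. -/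
def zigzag (k : ℕ) (r R : ℝ) : Set ℂ :=
  ⋃ j ∈ Finset.range (2 ^ (k + 1)),
    segment ℝ (outerVertex k R j) (innerVertex k r j) ∪
      segment ℝ (innerVertex k r j) (outerVertex k R (j + 1))

/-- The open region enclosed by a curve `Γ` that every ray from the origin meets exactly once. -/
def openInside (Γ : Set ℂ) : Set ℂ :=
  {z | ∃ p ∈ Γ, ∃ t : ℝ, 0 ≤ t ∧ t < 1 ∧ z = t • p}

/-- The curve `Γ` together with the region that it encloses. -/
def closedInside (Γ : Set ℂ) : Set ℂ :=
  {z | ∃ p ∈ Γ, ∃ t : ℝ, 0 ≤ t ∧ t ≤ 1 ∧ z = t • p}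

/-- The zigzag ribbon `ω_k`: the region between the outer boundary curve, with vertices on the
circles of radii `1` and `2`, and the inner boundary curve, with vertices on the circles of radii
`1 - ε` and `2 - ε`. -/
def ribbon (ε : ℝ) (k : ℕ) : Set ℂ :=
  openInside (zigzag k 1 2) \ closedInside (zigzag k (1 - ε) (2 - ε))

/-- The requirements on the cross section of a twisted tube: open, bounded, connected, and not
rotationally symmetric with respect to the origin. -/
def IsTubeCrossSection (Ω : Set ℂ) : Prop :=
  IsOpen Ω ∧ Bornology.IsBounded Ω ∧ IsConnected Ω ∧
    ¬ ∀ w : ℂ, ‖w‖ = 1 → (fun z => w * z) '' Ω = Ω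

/-- `d = sup {|t| : t ∈ Ω}`. -/
def crossRadius (Ω : Set ℂ) : ℝ := sSup ((fun z : ℂ => ‖z‖) '' Ω)

/-! ### Constants -/

/-- `γ = min {1/3, 1/(48 β₀² d²)}`, where `d` is the radius of `Ω`. -/
def gammaConst (β₀ : ℝ) (Ω : Set ℂ) : ℝ :=
  min (1 / 3) (1 / (48 * β₀ ^ 2 * crossRadius Ω ^ 2))

/-- `α = √(γ - 3 c)`. -/
def alphaConst (β₀ c : ℝ) (Ω : Set ℂ) : ℝ := Real.sqrt (gammaConst β₀ Ω - 3 * c)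

/-- The semiclassical constant `L_{σ,1}^{cl}`. -/
def semiclassicalConst (σ : ℝ) : ℝ :=
  Real.Gamma (σ + 1) / (Real.sqrt (4 * Real.pi) * Real.Gamma (σ + 3 / 2))

/-! ### Derivatives, test functions and `H₀¹` -/

section Derivatives

variable {F : Type*} [NormedAddCommGroup F] [NormedSpace ℝ F]

/-- The angular derivative `∂_α = t₂ ∂/∂t₃ - t₃ ∂/∂t₂`: the derivative at `z = t₂ + i t₃` in the
direction `i z = - t₃ + i t₂`. -/
def angDeriv (u : ℂ → F) (z : ℂ) : F := fderiv ℝ u z (Complex.I * z)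

/-- `|∇u|²`. -/
def gradSq (u : ℂ → F) (z : ℂ) : ℝ := ‖fderiv ℝ u z 1‖ ^ 2 + ‖fderiv ℝ u z Complex.I‖ ^ 2

/-- `u ∈ C₀^∞(Ω)`. -/
def IsTest (Ω : Set ℂ) (u : ℂ → F) : Prop :=
  ContDiff ℝ (⊤ : ℕ∞) u ∧ HasCompactSupport u ∧ tsupport u ⊆ Ω

end Derivatives

/-- `C₀^∞(Ω)` as a complex vector space. -/
def testSpace (Ω : Set ℂ) : Submodule ℂ (ℂ → ℂ) where
  carrier := {u | IsTest Ω u}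
  zero_mem' := ⟨contDiff_const, HasCompactSupport.zero, by simp [tsupport]⟩
  add_mem' := fun {u v} hu hv => ⟨hu.1.add hv.1, hu.2.1.add hv.2.1,
    (tsupport_add u v).trans (union_subset hu.2.2 hv.2.2)⟩
  smul_mem' := fun a u hu => ⟨contDiff_const.smul hu.1, hu.2.1.smul_left (f := fun _ => a),
    (tsupport_smul_subset_right (fun _ => a) u).trans hu.2.2⟩

/-- Membership in `H₀¹(Ω)` for a function that is differentiable in the open set `Ω`, so that its
weak gradient is the classical one: `f` is a limit of functions in `C₀^∞(Ω)` in the norm of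
`H¹(Ω)`. -/
def MemH10 (Ω : Set ℂ) (f : ℂ → ℝ) : Prop :=
  ∃ g : ℕ → ℂ → ℝ, (∀ n, IsTest Ω (g n)) ∧
    Tendsto (fun n => ∫⁻ z in Ω, ENNReal.ofReal ((g n z - f z) ^ 2)) atTop (𝓝 0) ∧
    Tendsto (fun n => ∫⁻ z in Ω, ENNReal.ofReal (gradSq (fun w => g n w - f w) z)) atTop (𝓝 0)

/-! ### The operator `h_{β₀}` and its ground state -/

/-- The quadratic form of `h_{β₀} = -Δ_D^Ω - β₀² ∂_α²`. -/
def hForm (Ω : Set ℂ) (β₀ : ℝ) (u : ℂ → ℂ) : ℝ :=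
  ∫ z in Ω, (gradSq u z + β₀ ^ 2 * ‖angDeriv u z‖ ^ 2)

/-- `E = inf σ(h_{β₀})`, the bottom of the spectrum of the self-adjoint operator associated with the
closure of the form. -/
def specBottom (Ω : Set ℂ) (β₀ : ℝ) : ℝ :=
  sInf {q : ℝ | ∃ u ∈ testSpace Ω, (∫ z in Ω, ‖u z‖ ^ 2) = 1 ∧ q = hForm Ω β₀ u}

/-- `f` is the ground-state eigenfunction of `h_{β₀}` on `L²(Ω)` (determined up to a positive
factor): it lies in `H₀¹(Ω)`, is strictly positive and twice continuously differentiable in `Ω`, and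
satisfies `-Δ f - β₀² ∂_α² f = E f` there. -/
structure IsGroundState (Ω : Set ℂ) (β₀ : ℝ) (f : ℂ → ℝ) : Prop where
  contDiffAt : ∀ z ∈ Ω, ContDiffAt ℝ 2 f z
  pos : ∀ z ∈ Ω, 0 < f z
  memH10 : MemH10 Ω f
  eigen : ∀ z ∈ Ω,
    -Laplacian.laplacian f z - β₀ ^ 2 * angDeriv (angDeriv f) z = specBottom Ω β₀ * f z

/-! ### The operator `H(s)` -/

/-- The potential `-(1/α²) (m' ∂_α f / f - m (2 β₀ - m) ∂_α² f / f)`, in which `m` and `m'` stand for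
the values of `μ` and of its derivative at the point `s`. -/
def potential (β₀ α : ℝ) (f : ℂ → ℝ) (m dm : ℝ) (z : ℂ) : ℝ :=
  -(1 / α ^ 2) * (dm * (angDeriv f z / f z)
    - m * (2 * β₀ - m) * (angDeriv (angDeriv f) z / f z))

/-- The quadratic form `⟨u, H(s) u⟩` on `C₀^∞(Ω)`, where
`H(s) = -Δ_D^Ω - β₀² ∂_α² - (1/α²) (m' ∂_α f / f - m (2 β₀ - m) ∂_α² f / f) - E`. -/
def HForm (Ω : Set ℂ) (β₀ α : ℝ) (f : ℂ → ℝ) (m dm : ℝ) (u : ℂ → ℂ) : ℝ :=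
  ∫ z in Ω, (gradSq u z + β₀ ^ 2 * ‖angDeriv u z‖ ^ 2
    + (potential β₀ α f m dm z - specBottom Ω β₀) * ‖u z‖ ^ 2)

/-- The ground-state eigenvalue `λ₁(s) = inf {⟨u, H(s) u⟩ : ‖u‖ = 1}` of the self-adjoint
operator associated with the form (`⊥` if the form is not bounded from below). -/
def groundEigenvalue (Ω : Set ℂ) (β₀ α : ℝ) (f : ℂ → ℝ) (m dm : ℝ) : EReal :=
  ⨅ u ∈ testSpace Ω, ⨅ _ : (∫ z in Ω, ‖u z‖ ^ 2) = 1, ((HForm Ω β₀ α f m dm u : ℝ) : EReal)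

/-- The `n`-th eigenvalue (`n = 0, 1, …`, counted with multiplicity) of `H(s)` by the minimax
principle; it is the bottom of the essential spectrum if there are at most `n` eigenvalues below
it. -/
def minimaxEigenvalue (Ω : Set ℂ) (β₀ α : ℝ) (f : ℂ → ℝ) (m dm : ℝ) (n : ℕ) : EReal :=
  ⨅ L : Submodule ℂ (ℂ → ℂ), ⨅ _ : L ≤ testSpace Ω ∧ Module.finrank ℂ L = n + 1,
    ⨆ u ∈ L, ⨆ _ : (∫ z in Ω, ‖u z‖ ^ 2) = 1, ((HForm Ω β₀ α f m dm u : ℝ) : EReal)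

/-- `tr H(s)_-^p`, the sum of `|λ|^p` over the negative spectrum. -/
def traceNegPow (Ω : Set ℂ) (β₀ α : ℝ) (f : ℂ → ℝ) (m dm p : ℝ) : ℝ≥0∞ :=
  ∑' n : ℕ, (-(minimaxEigenvalue Ω β₀ α f m dm n)).toENNReal ^ p

/-- The right-hand side `α^{2σ} L_{σ,1}^{cl} ∫ tr H(s)_-^{σ + 1/2} ds` of the Lieb–Thirring
estimate; `dμ` is the derivative of `μ`. -/
def liebThirringRHS (Ω : Set ℂ) (β₀ α : ℝ) (f : ℂ → ℝ) (μ dμ : ℝ → ℝ) (σ : ℝ) : ℝ≥0∞ :=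
  ENNReal.ofReal (α ^ (2 * σ) * semiclassicalConst σ) *
    ∫⁻ s : ℝ, traceNegPow Ω β₀ α f (μ s) (dμ s) (σ + 1 / 2)

end FoldedRibbon

end

/-! The bound comes from testing the form with $u=f\varphi$, where $f$ is the ground state and
$\varphi$ is a cut-off close to $1$. Put $M=\mu(2\beta_0-\mu)/\alpha^2\ge0$. Because $f$ solves the
eigenvalue equation, $E$ disappears from the form density, and moving the angular derivatives off
$\partial_\alpha^2f$ turns the potential $M\,\partial_\alpha^2f/f$ into $-M\int(\partial_\alpha
u)^2$. What remains, up to divergences (`formDensity_mul_cutoff`, `integral_divergenceTerm`), is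
quadratic in $f\nabla\varphi$, apart from one $\dot\mu$-term that is linear in
$f\,\partial_\alpha\varphi$ and is absorbed by Young's inequality.

The remainder can be made small relative to $\int u^2$ (`exists_cutoff`): since $f\in H_0^1$ is a
limit of test functions $g_n$, the cut-offs $F(g_n/f)$ with a smooth step $F$ have energy $\int
f^2|\nabla\varphi|^2\to0$, while their mass does not vanish. Hence $\lambda_1\le-MK$ for every
constant $K$ in an angular Poincaré inequality $K\int u^2\le\int(\partial_\alpha u)^2$
(`exists_trial_function`, `groundEigenvalue_le`).

The folding of the ribbon makes $K$ large. On the rays through inner vertices the ribbon stays below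
radius $1$; on those through outer vertices it stays above $2-\varepsilon>1$. So every circle about
the origin leaves the ribbon at $2^{k+1}$ equally spaced angles, and the Dirichlet inequality on
arcs of angle $2\delta_k$ allows every $K<(\pi/2\delta_k)^2=4^k$ (`poincare_circle`,
`poincare_ribbon`).

The target constant $4^{k+1}/\pi^2$ is smaller by the factor $\pi^2/4$. Replacing $\pi$ by $3.1$
keeps the factor $2.4025=(3.1/2)^2$. This surplus gives strictness in (b). In (c), where only the
lowest eigenvalue is kept in the trace, it compensates for $L^{\rm cl}_{\sigma,1}$
(`one_le_semiclassicalConst_mul`). -/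

noncomputable section

namespace FoldedRibbon

/-! ### The zigzag curves in polar coordinates -/

/-- Half of the angle between two consecutive outer vertices. -/
def halfStep (k : ℕ) : ℝ := Real.pi / 2 ^ (k + 1)

lemma halfStep_pos (k : ℕ) : 0 < halfStep k := by unfold halfStep; positivity

lemma two_pow_mul_halfStep (k : ℕ) : 2 ^ (k + 1) * halfStep k = Real.pi := by
  unfold halfStep; field_simp

lemma halfStep_le (k : ℕ) : halfStep k ≤ Real.pi / 2 := by
  unfold halfStep
  apply div_le_div_of_nonneg_left Real.pi_pos.le (by norm_num)
  calc (2 : ℝ) = 2 ^ 1 := by norm_num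
    _ ≤ 2 ^ (k + 1) := pow_le_pow_right₀ (by norm_num) (by omega)

lemma sin_halfStep_pos (k : ℕ) : 0 < Real.sin (halfStep k) :=
  Real.sin_pos_of_pos_of_lt_pi (halfStep_pos k)
    (by linarith [halfStep_le k, Real.pi_pos])

/-- The distance of the angle `θ` to the nearest outer vertex angle. -/
def angleDist (k : ℕ) (θ : ℝ) : ℝ :=
  Real.arccos (Real.cos (2 ^ (k + 1) * θ)) / 2 ^ (k + 1)

lemma continuous_angleDist (k : ℕ) : Continuous (angleDist k) := by
  unfold angleDist
  exact (Real.continuous_arccos.comp (Real.continuous_cos.comp (by fun_prop))).div_const _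

lemma angleDist_nonneg (k : ℕ) (θ : ℝ) : 0 ≤ angleDist k θ :=
  div_nonneg (Real.arccos_nonneg _) (by positivity)

lemma angleDist_le (k : ℕ) (θ : ℝ) : angleDist k θ ≤ halfStep k :=
  div_le_div_of_nonneg_right (Real.arccos_le_pi _) (by positivity)

lemma angleDist_neg (k : ℕ) (θ : ℝ) : angleDist k (-θ) = angleDist k θ := by
  simp [angleDist]

lemma angleDist_add_int_mul (k : ℕ) (θ : ℝ) (m : ℤ) :
    angleDist k (θ + 2 * m * halfStep k) = angleDist k θ := by
  have : (2 : ℝ) ^ (k + 1) * (θ + 2 * m * halfStep k)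
      = 2 ^ (k + 1) * θ + m * (2 * Real.pi) := by
    rw [← two_pow_mul_halfStep k]; ring
  rw [angleDist, this, Real.cos_add_int_mul_two_pi, angleDist]

lemma angleDist_eq_self {k : ℕ} {θ : ℝ} (h0 : 0 ≤ θ) (h1 : θ ≤ halfStep k) :
    angleDist k θ = θ := by
  rw [angleDist, Real.arccos_cos (by positivity), mul_div_cancel_left₀ _ (by positivity)]
  rw [← two_pow_mul_halfStep k]
  gcongr

/-- The reciprocal of the radius of the zigzag curve in the direction of angle `θ`. -/
def invRadius (k : ℕ) (r R θ : ℝ) : ℝ :=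
  (Real.sin (halfStep k - angleDist k θ) / R + Real.sin (angleDist k θ) / r) /
    Real.sin (halfStep k)

lemma continuous_invRadius (k : ℕ) (r R : ℝ) : Continuous (invRadius k r R) := by
  unfold invRadius
  have := continuous_angleDist k
  fun_prop

lemma sin_angleDist_nonneg (k : ℕ) (θ : ℝ) : 0 ≤ Real.sin (angleDist k θ) :=
  Real.sin_nonneg_of_nonneg_of_le_pi (angleDist_nonneg k θ)
    (by linarith [angleDist_le k θ, halfStep_le k, Real.pi_pos])

lemma sin_sub_angleDist_nonneg (k : ℕ) (θ : ℝ) : 0 ≤ Real.sin (halfStep k - angleDist k θ) :=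
  Real.sin_nonneg_of_nonneg_of_le_pi (by linarith [angleDist_le k θ])
    (by linarith [angleDist_nonneg k θ, halfStep_le k, Real.pi_pos])

lemma sin_angleDist_pos_or (k : ℕ) (θ : ℝ) :
    0 < Real.sin (angleDist k θ) ∨ 0 < Real.sin (halfStep k - angleDist k θ) := by
  rcases (angleDist_nonneg k θ).eq_or_lt with h | h
  · right; rw [← h, sub_zero]; exact sin_halfStep_pos k
  · left
    exact Real.sin_pos_of_pos_of_lt_pi h
      (by linarith [angleDist_le k θ, halfStep_le k, Real.pi_pos])

lemma invRadius_lt_invRadius (k : ℕ) {r R r' R' : ℝ} (θ : ℝ) (hr' : 0 < r') (hR' : 0 < R')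
    (hr : r' < r) (hR : R' < R) : invRadius k r R θ < invRadius k r' R' θ := by
  unfold invRadius
  apply div_lt_div_of_pos_right _ (sin_halfStep_pos k)
  have h1 := sin_angleDist_nonneg k θ
  have h2 := sin_sub_angleDist_nonneg k θ
  rcases sin_angleDist_pos_or k θ with h | h
  · exact add_lt_add_of_le_of_lt (by gcongr) (by gcongr)
  · exact add_lt_add_of_lt_of_le (by gcongr) (by gcongr)

lemma invRadius_pos (k : ℕ) {r R : ℝ} (θ : ℝ) (hr : 0 < r) (hR : 0 < R) :
    0 < invRadius k r R θ := by
  unfold invRadius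
  apply div_pos _ (sin_halfStep_pos k)
  have h1 := sin_angleDist_nonneg k θ
  have h2 := sin_sub_angleDist_nonneg k θ
  rcases sin_angleDist_pos_or k θ with h | h <;> positivity

lemma invRadius_even (k : ℕ) (r R : ℝ) (m : ℤ) :
    invRadius k r R (2 * m * halfStep k) = 1 / R := by
  have h : angleDist k (2 * m * halfStep k) = 0 := by
    have := angleDist_add_int_mul k 0 m
    rw [zero_add] at this
    rw [this, angleDist_eq_self le_rfl (halfStep_pos k).le]
  have := (sin_halfStep_pos k).ne'
  simp only [invRadius, h, sub_zero, Real.sin_zero, zero_div, add_zero]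
  field_simp

lemma invRadius_odd (k : ℕ) (r R : ℝ) (m : ℤ) :
    invRadius k r R ((2 * m + 1) * halfStep k) = 1 / r := by
  have h : angleDist k ((2 * m + 1) * halfStep k) = halfStep k := by
    have := angleDist_add_int_mul k (halfStep k) m
    rw [angleDist_eq_self (halfStep_pos k).le le_rfl] at this
    rwa [show (2 * (m : ℝ) + 1) * halfStep k = halfStep k + 2 * m * halfStep k by ring]
  have := (sin_halfStep_pos k).ne'
  simp only [invRadius, h, sub_self, Real.sin_zero, zero_div, zero_add]
  field_simp

/-- The point with polar coordinates `(s, θ)`. -/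
def polarPoint (s θ : ℝ) : ℂ := (s : ℂ) * Complex.exp ((θ : ℂ) * Complex.I)

lemma polarPoint_re (s θ : ℝ) : (polarPoint s θ).re = s * Real.cos θ := by
  simp [polarPoint, Complex.exp_ofReal_mul_I_re]

lemma polarPoint_im (s θ : ℝ) : (polarPoint s θ).im = s * Real.sin θ := by
  simp [polarPoint, Complex.exp_ofReal_mul_I_im]

lemma norm_polarPoint {s : ℝ} (hs : 0 ≤ s) (θ : ℝ) : ‖polarPoint s θ‖ = s := by
  simp [polarPoint, Complex.norm_exp_ofReal_mul_I, abs_of_nonneg hs]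

lemma polarPoint_add_int (s θ : ℝ) (m : ℤ) :
    polarPoint s (θ + m * (2 * Real.pi)) = polarPoint s θ := by
  apply Complex.ext <;> simp [polarPoint_re, polarPoint_im]

lemma polarPoint_norm_arg (z : ℂ) : polarPoint ‖z‖ z.arg = z :=
  Complex.norm_mul_exp_arg_mul_I z

lemma smul_polarPoint (t s θ : ℝ) : t • polarPoint s θ = polarPoint (t * s) θ := by
  simp [polarPoint, mul_assoc]

lemma polarPoint_ne_zero {s : ℝ} (hs : 0 < s) (θ : ℝ) : polarPoint s θ ≠ 0 := by
  rw [← norm_pos_iff, norm_polarPoint hs.le]; exact hs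

lemma mem_segment_iff_polar (r R x y : ℝ) (p : ℂ) :
    p ∈ segment ℝ (polarPoint R x) (polarPoint r y) ↔
      ∃ a b : ℝ, 0 ≤ a ∧ 0 ≤ b ∧ a + b = 1 ∧
        p = polarPoint (a * R) x + polarPoint (b * r) y := by
  simp only [segment, mem_ofPred_eq, smul_polarPoint]
  constructor
  · rintro ⟨a, b, h1, h2, h3, h4⟩; exact ⟨a, b, h1, h2, h3, h4.symm⟩
  · rintro ⟨a, b, h1, h2, h3, h4⟩; exact ⟨a, b, h1, h2, h3, h4.symm⟩

lemma outerVertex_eq (k : ℕ) (R : ℝ) (j : ℕ) :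
    outerVertex k R j = polarPoint R (2 * j * halfStep k) := rfl

lemma innerVertex_eq (k : ℕ) (r : ℝ) (j : ℕ) :
    innerVertex k r j = polarPoint r ((2 * j + 1) * halfStep k) := rfl

/-- Regroups the segments by outer vertex, each with one edge to either side, and lets the index
range over all integers. Rotation and reflection then reduce every question to the single sector of
angles $[0,\delta_k]$. -/
lemma mem_zigzag_iff (k : ℕ) (r R : ℝ) (p : ℂ) :
    p ∈ zigzag k r R ↔ ∃ m : ℤ, ∃ a b : ℝ, 0 ≤ a ∧ 0 ≤ b ∧ a + b = 1 ∧
      (p = polarPoint (a * R) (2 * m * halfStep k)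
          + polarPoint (b * r) (2 * m * halfStep k + halfStep k) ∨
        p = polarPoint (a * R) (2 * m * halfStep k)
          + polarPoint (b * r) (2 * m * halfStep k - halfStep k)) := by
  simp only [zigzag, mem_iUnion, mem_union, Finset.mem_range, exists_prop]
  constructor
  · rintro ⟨j, -, h | h⟩
    · rw [outerVertex_eq, innerVertex_eq, mem_segment_iff_polar] at h
      obtain ⟨a, b, ha, hb, hab, rfl⟩ := h
      refine ⟨j, a, b, ha, hb, hab, Or.inl ?_⟩
      push_cast; ring_nf
    · rw [segment_symm, outerVertex_eq, innerVertex_eq, mem_segment_iff_polar] at h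
      obtain ⟨a, b, ha, hb, hab, rfl⟩ := h
      refine ⟨j + 1, a, b, ha, hb, hab, Or.inr ?_⟩
      push_cast; ring_nf
  · rintro ⟨m, a, b, ha, hb, hab, h⟩
    have hN : (0 : ℤ) < 2 ^ (k + 1) := by positivity
    have key : ∀ n : ℤ, ∃ j : ℕ, j < 2 ^ (k + 1) ∧ ∃ q : ℤ, ∀ s x : ℝ,
        polarPoint s (2 * n * halfStep k + x) = polarPoint s (2 * j * halfStep k + x) := by
      intro n
      have h0 := Int.emod_nonneg n hN.ne'
      have h1 := Int.emod_lt_of_pos n hN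
      refine ⟨(n % 2 ^ (k + 1)).toNat, by zify; rw [Int.toNat_of_nonneg h0]; exact h1,
        n / 2 ^ (k + 1), fun s x => ?_⟩
      have hn : (n : ℝ) = ((n % 2 ^ (k + 1)).toNat : ℝ)
          + 2 ^ (k + 1) * ((n / 2 ^ (k + 1) : ℤ) : ℝ) := by
        have := Int.emod_add_mul_ediv n (2 ^ (k + 1))
        have h2 : ((n % 2 ^ (k + 1)).toNat : ℝ) = ((n % 2 ^ (k + 1) : ℤ) : ℝ) := by
          rw [← Int.cast_natCast, Int.toNat_of_nonneg h0]
        rw [h2]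
        exact_mod_cast this.symm
      rw [← polarPoint_add_int s (2 * ((n % 2 ^ (k + 1)).toNat : ℝ) * halfStep k + x)
        (n / 2 ^ (k + 1))]
      congr 1
      rw [hn]
      have := two_pow_mul_halfStep k
      linear_combination (2 * ((n / 2 ^ (k + 1) : ℤ) : ℝ)) * this
    rcases h with rfl | rfl
    · obtain ⟨j, hj, -, hjs⟩ := key m
      refine ⟨j, hj, Or.inl ?_⟩
      rw [outerVertex_eq, innerVertex_eq, mem_segment_iff_polar]
      refine ⟨a, b, ha, hb, hab, ?_⟩
      have h1 := hjs (a * R) 0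
      rw [add_zero, add_zero] at h1
      rw [h1, hjs]; ring_nf
    -- The edge going backwards from outer vertex $m$ is the second segment of index $m-1$, hence
    -- the shift.
    · obtain ⟨j, hj, -, hjs⟩ := key (m - 1)
      refine ⟨j, hj, Or.inr ?_⟩
      rw [segment_symm, outerVertex_eq, innerVertex_eq, mem_segment_iff_polar]
      refine ⟨a, b, ha, hb, hab, ?_⟩
      have h1 := hjs (a * R) (2 * halfStep k)
      have h2 := hjs (b * r) (halfStep k)
      push_cast at h1 h2 ⊢
      ring_nf at h1 h2 ⊢
      rw [h1, h2]

/-- In polar coordinates the reciprocal radius along a line is a combination of $\cos\psi$ and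
$\sin\psi$. Concretely, $s\sin\psi=br\sin\delta_k$ and $s\sin(\delta_k-\psi)=aR\sin\delta_k$;
nonnegativity of $a,b$ puts $\psi$ modulo $2\pi$ in $[0,\delta_k]$, and $a+b=1$ is the claimed
equation. -/
lemma polar_of_convexCombination {k : ℕ} {r R s ψ a b : ℝ} (hr : 0 < r) (hR : 0 < R)
    (hs : 0 < s) (ha : 0 ≤ a) (hb : 0 ≤ b) (hab : a + b = 1)
    (h : polarPoint s ψ = polarPoint (a * R) 0 + polarPoint (b * r) (halfStep k)) :
    s * invRadius k r R ψ = 1 := by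
  have hd := halfStep_pos k
  have hd2 := halfStep_le k
  have hsd := sin_halfStep_pos k
  have hpi := Real.pi_pos
  obtain ⟨φ, m, hψ, hφ1, hφ2⟩ : ∃ φ : ℝ, ∃ m : ℤ, ψ = φ + m * (2 * Real.pi) ∧
      -Real.pi < φ ∧ φ ≤ Real.pi := by
    refine ⟨toIocMod Real.two_pi_pos (-Real.pi) ψ, toIocDiv Real.two_pi_pos (-Real.pi) ψ, ?_, ?_⟩
    · have := toIocMod_add_toIocDiv_zsmul Real.two_pi_pos (-Real.pi) ψ
      rw [zsmul_eq_mul] at this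
      exact this.symm
    · have := toIocMod_mem_Ioc Real.two_pi_pos (-Real.pi) ψ
      exact ⟨this.1, by linarith [this.2]⟩
  subst hψ
  rw [polarPoint_add_int] at h
  have hre := congrArg Complex.re h
  have him := congrArg Complex.im h
  simp only [polarPoint_re, polarPoint_im, Complex.add_re, Complex.add_im, Real.cos_zero,
    Real.sin_zero, mul_zero, mul_one, zero_add] at hre him
  have hsub : s * Real.sin (halfStep k - φ) = a * R * Real.sin (halfStep k) := by
    rw [Real.sin_sub]
    linear_combination Real.sin (halfStep k) * hre - Real.cos (halfStep k) * him
  have hs1 : 0 ≤ Real.sin φ := by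
    have : 0 ≤ s * Real.sin φ := by rw [him]; positivity
    exact nonneg_of_mul_nonneg_right this hs
  have hs2 : 0 ≤ Real.sin (halfStep k - φ) := by
    have : 0 ≤ s * Real.sin (halfStep k - φ) := by rw [hsub]; positivity
    exact nonneg_of_mul_nonneg_right this hs
  have h0 : 0 ≤ φ := by
    by_contra hneg
    exact absurd (Real.sin_neg_of_neg_of_neg_pi_lt (not_le.mp hneg) hφ1) (not_lt.mpr hs1)
  have h1 : φ ≤ halfStep k := by
    by_contra hneg
    exact absurd (Real.sin_neg_of_neg_of_neg_pi_lt (x := halfStep k - φ) (by linarith)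
      (by linarith)) (not_lt.mpr hs2)
  have hτ : angleDist k (φ + m * (2 * Real.pi)) = φ := by
    have := angleDist_add_int_mul k φ (2 ^ (k + 1) * m)
    rw [angleDist_eq_self h0 h1] at this
    rwa [show φ + 2 * ((2 ^ (k + 1) * m : ℤ) : ℝ) * halfStep k = φ + m * (2 * Real.pi) by
      push_cast
      linear_combination (2 * (m : ℝ)) * two_pow_mul_halfStep k] at this
  rw [invRadius, hτ]
  field_simp
  rw [mul_add]
  linear_combination r * hsub + R * him + (r * R * Real.sin (halfStep k)) * hab

lemma polarPoint_rotate {s₁ s₂ s₃ x y z : ℝ} (t : ℝ)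
    (h : polarPoint s₁ x = polarPoint s₂ y + polarPoint s₃ z) :
    polarPoint s₁ (x + t) = polarPoint s₂ (y + t) + polarPoint s₃ (z + t) := by
  have key : ∀ s x : ℝ, polarPoint s (x + t)
      = polarPoint s x * Complex.exp ((t : ℂ) * Complex.I) := by
    intro s x
    simp [polarPoint, add_mul, Complex.exp_add, mul_assoc]
  rw [key, key, key, h, add_mul]

lemma polarPoint_reflect {s₁ s₂ s₃ x y z : ℝ}
    (h : polarPoint s₁ x = polarPoint s₂ y + polarPoint s₃ z) :
    polarPoint s₁ (-x) = polarPoint s₂ (-y) + polarPoint s₃ (-z) := by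
  have key : ∀ s x : ℝ, polarPoint s (-x) = (starRingEnd ℂ) (polarPoint s x) := by
    intro s x
    apply Complex.ext <;> simp [polarPoint_re, polarPoint_im]
  rw [key, key, key, h, map_add]

lemma invRadius_neg (k : ℕ) (r R θ : ℝ) : invRadius k r R (-θ) = invRadius k r R θ := by
  simp only [invRadius, angleDist_neg]

lemma invRadius_add_int_mul (k : ℕ) (r R θ : ℝ) (m : ℤ) :
    invRadius k r R (θ + 2 * m * halfStep k) = invRadius k r R θ := by
  simp only [invRadius, angleDist_add_int_mul]

lemma convexCombination_of_polar {k : ℕ} {r R s ψ : ℝ} (hr : 0 < r) (hR : 0 < R)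
    (hs : 0 < s) (h0 : 0 ≤ ψ) (h1 : ψ ≤ halfStep k) (h : s * invRadius k r R ψ = 1) :
    ∃ a b : ℝ, 0 ≤ a ∧ 0 ≤ b ∧ a + b = 1 ∧
      polarPoint s ψ = polarPoint (a * R) 0 + polarPoint (b * r) (halfStep k) := by
  have hsd := sin_halfStep_pos k
  have e1 := sin_angleDist_nonneg k ψ
  have e2 := sin_sub_angleDist_nonneg k ψ
  rw [invRadius] at h
  rw [angleDist_eq_self h0 h1] at e1 e2 h
  refine ⟨s * Real.sin (halfStep k - ψ) / (R * Real.sin (halfStep k)),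
    s * Real.sin ψ / (r * Real.sin (halfStep k)), by positivity, by positivity, ?_, ?_⟩
  · rw [← h]; field_simp
  · apply Complex.ext
    · simp only [polarPoint_re, Complex.add_re, Real.cos_zero, Real.sin_sub]
      field_simp
      ring
    · simp only [polarPoint_im, Complex.add_im, Real.sin_zero]
      field_simp
      ring

lemma polarPoint_mem_zigzag_iff {k : ℕ} {r R s θ : ℝ} (hr : 0 < r) (hR : 0 < R) (hs : 0 < s) :
    polarPoint s θ ∈ zigzag k r R ↔ s * invRadius k r R θ = 1 := by
  rw [mem_zigzag_iff]
  constructor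
  · rintro ⟨m, a, b, ha, hb, hab, h | h⟩
    · have := polarPoint_rotate (-(2 * m * halfStep k)) h
      rw [← invRadius_add_int_mul k r R θ (-m)]
      refine polar_of_convexCombination hr hR hs ha hb hab ?_
      push_cast
      ring_nf at this ⊢
      exact this
    · have := polarPoint_reflect (polarPoint_rotate (-(2 * m * halfStep k)) h)
      rw [← invRadius_add_int_mul k r R θ (-m), ← invRadius_neg]
      refine polar_of_convexCombination hr hR hs ha hb hab ?_
      push_cast
      ring_nf at this ⊢
      exact this
  · intro h
    have hd := halfStep_pos k
    -- The nearest outer ray, so the remaining angle has absolute value at most $\delta_k$; its sign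
    -- selects the edge.
    set m : ℤ := round (θ / (2 * halfStep k)) with hm
    have hround := abs_sub_round (θ / (2 * halfStep k))
    rw [← hm] at hround
    set ψ : ℝ := θ + 2 * ((-m : ℤ) : ℝ) * halfStep k with hψ
    have hψd : |ψ| ≤ halfStep k := by
      have : ψ = (θ / (2 * halfStep k) - m) * (2 * halfStep k) := by
        rw [hψ]; push_cast; field_simp; ring
      rw [this, abs_mul, abs_of_pos (by positivity : 0 < 2 * halfStep k)]
      nlinarith
    have hθ : θ = ψ + 2 * m * halfStep k := by rw [hψ]; push_cast; ring
    have hN : s * invRadius k r R ψ = 1 := by rw [hψ, invRadius_add_int_mul, h]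
    rcases le_total 0 ψ with hp | hp
    · obtain ⟨a, b, ha, hb, hab, h⟩ := convexCombination_of_polar hr hR hs hp
        ((le_abs_self _).trans hψd) hN
      refine ⟨m, a, b, ha, hb, hab, Or.inl ?_⟩
      have := polarPoint_rotate (2 * m * halfStep k) h
      rw [hθ, this]; ring_nf
    · rw [← invRadius_neg] at hN
      obtain ⟨a, b, ha, hb, hab, h⟩ := convexCombination_of_polar hr hR hs (neg_nonneg.mpr hp)
        ((neg_le_abs _).trans hψd) hN
      refine ⟨m, a, b, ha, hb, hab, Or.inr ?_⟩
      have := polarPoint_rotate (2 * m * halfStep k) (polarPoint_reflect h)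
      rw [hθ]
      ring_nf at this ⊢
      exact this

/-- Each ray meets the curve exactly once, at radius `1 / invRadius k r R θ`. Both kinds of inside
therefore become inequalities for `s * invRadius k r R θ`. -/
lemma exists_smul_mem_zigzag_iff {k : ℕ} {r R s θ t : ℝ} (hr : 0 < r) (hR : 0 < R) (hs : 0 < s)
    (ht : 0 ≤ t) :
    (∃ p ∈ zigzag k r R, polarPoint s θ = t • p) ↔ s * invRadius k r R θ = t := by
  have hn := invRadius_pos k θ hr hR
  constructor
  · rintro ⟨p, hp, h⟩
    have ht0 : 0 < t := by
      rcases ht.eq_or_lt with h0 | h0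
      · rw [← h0, zero_smul] at h
        exact absurd h (polarPoint_ne_zero hs θ)
      · exact h0
    have hp' : p = polarPoint (s / t) θ := by
      have : t⁻¹ • polarPoint s θ = p := by rw [h, smul_smul, inv_mul_cancel₀ ht0.ne', one_smul]
      rw [← this, smul_polarPoint]; congr 1; ring
    rw [hp', polarPoint_mem_zigzag_iff hr hR (by positivity)] at hp
    field_simp at hp
    exact hp
  · intro h
    refine ⟨polarPoint (1 / invRadius k r R θ) θ, ?_, ?_⟩
    · rw [polarPoint_mem_zigzag_iff hr hR (by positivity)]
      field_simp
    · rw [smul_polarPoint, ← h]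
      congr 1
      field_simp

lemma polarPoint_mem_openInside_iff {k : ℕ} {r R s θ : ℝ} (hr : 0 < r) (hR : 0 < R)
    (hs : 0 < s) : polarPoint s θ ∈ openInside (zigzag k r R) ↔ s * invRadius k r R θ < 1 := by
  have hn := invRadius_pos k θ hr hR
  constructor
  · rintro ⟨p, hp, t, ht0, ht1, h⟩
    rwa [(exists_smul_mem_zigzag_iff hr hR hs ht0).mp ⟨p, hp, h⟩]
  · intro h
    have ht0 : 0 ≤ s * invRadius k r R θ := by positivity
    obtain ⟨p, hp, e⟩ := (exists_smul_mem_zigzag_iff hr hR hs ht0).mpr rfl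
    exact ⟨p, hp, _, ht0, h, e⟩

lemma polarPoint_mem_closedInside_iff {k : ℕ} {r R s θ : ℝ} (hr : 0 < r) (hR : 0 < R)
    (hs : 0 < s) : polarPoint s θ ∈ closedInside (zigzag k r R) ↔ s * invRadius k r R θ ≤ 1 := by
  have hn := invRadius_pos k θ hr hR
  constructor
  · rintro ⟨p, hp, t, ht0, ht1, h⟩
    rwa [(exists_smul_mem_zigzag_iff hr hR hs ht0).mp ⟨p, hp, h⟩]
  · intro h
    have ht0 : 0 ≤ s * invRadius k r R θ := by positivity
    obtain ⟨p, hp, e⟩ := (exists_smul_mem_zigzag_iff hr hR hs ht0).mpr rfl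
    exact ⟨p, hp, _, ht0, h, e⟩

lemma zero_mem_closedInside_zigzag {k : ℕ} {r R : ℝ} (hr : 0 < r) (hR : 0 < R) :
    (0 : ℂ) ∈ closedInside (zigzag k r R) := by
  have hn := invRadius_pos k 0 hr hR
  refine ⟨polarPoint (1 / invRadius k r R 0) 0, ?_, 0, le_rfl, zero_le_one, by simp⟩
  rw [polarPoint_mem_zigzag_iff hr hR (by positivity)]
  field_simp

/-! ### The ribbon -/

lemma polarPoint_mem_ribbon_iff {ε : ℝ} (hε1 : ε < 1) {k : ℕ} {s θ : ℝ} (hs : 0 < s) :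
    polarPoint s θ ∈ ribbon ε k ↔
      s * invRadius k 1 2 θ < 1 ∧ 1 < s * invRadius k (1 - ε) (2 - ε) θ := by
  rw [ribbon, Set.mem_sdiff, polarPoint_mem_openInside_iff one_pos two_pos hs,
    polarPoint_mem_closedInside_iff (by linarith) (by linarith) hs, not_le]

lemma zero_notMem_ribbon {ε : ℝ} (hε1 : ε < 1) (k : ℕ) : (0 : ℂ) ∉ ribbon ε k :=
  fun h => h.2 (zero_mem_closedInside_zigzag (by linarith) (by linarith))

lemma polarPoint_exp (w : ℂ) : polarPoint (Real.exp w.re) w.im = Complex.exp w := by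
  rw [polarPoint, Complex.ofReal_exp, ← Complex.exp_add, Complex.re_add_im]

/-- Logarithmic coordinates avoid the branch cut of the argument: the set upstairs is open by
continuity of the reciprocal radii, and the exponential is an open map. -/
lemma ribbon_eq_image {ε : ℝ} (hε1 : ε < 1) (k : ℕ) :
    ribbon ε k = Complex.exp '' {w | Real.exp w.re * invRadius k 1 2 w.im < 1 ∧
      1 < Real.exp w.re * invRadius k (1 - ε) (2 - ε) w.im} := by
  ext z
  constructor
  · intro hz
    have h0 : z ≠ 0 := fun h => zero_notMem_ribbon hε1 k (h ▸ hz)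
    refine ⟨Complex.log z, ?_, Complex.exp_log h0⟩
    rw [mem_ofPred_eq, ← polarPoint_mem_ribbon_iff hε1 (Real.exp_pos _), polarPoint_exp,
      Complex.exp_log h0]
    exact hz
  · rintro ⟨w, hw, rfl⟩
    rw [← polarPoint_exp, polarPoint_mem_ribbon_iff hε1 (Real.exp_pos _)]
    exact hw

lemma isOpen_ribbon {ε : ℝ} (hε1 : ε < 1) (k : ℕ) : IsOpen (ribbon ε k) := by
  rw [ribbon_eq_image hε1]
  apply Complex.isOpenMap_exp
  have h1 := (continuous_invRadius k 1 2).comp Complex.continuous_im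
  have h2 := (continuous_invRadius k (1 - ε) (2 - ε)).comp Complex.continuous_im
  have h3 := Real.continuous_exp.comp Complex.continuous_re
  exact (isOpen_lt (h3.mul h1) continuous_const).inter (isOpen_lt continuous_const (h3.mul h2))

lemma polarPoint_mem_ribbon_of_even {ε : ℝ} (hε1 : ε < 1) (k : ℕ) {s : ℝ}
    (h1 : 2 - ε < s) (h2 : s < 2) (m : ℤ) :
    polarPoint s (2 * m * halfStep k) ∈ ribbon ε k := by
  have : 0 < 2 - ε := by linarith
  rw [polarPoint_mem_ribbon_iff hε1 (by linarith), invRadius_even, invRadius_even]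
  constructor
  · linarith
  · rw [mul_one_div, lt_div_iff₀ this]; linarith

lemma polarPoint_notMem_ribbon_of_even {ε : ℝ} (hε1 : ε < 1) (k : ℕ) {s : ℝ}
    (hs : 0 < s) (h : s ≤ 2 - ε) (m : ℤ) :
    polarPoint s (2 * m * halfStep k) ∉ ribbon ε k := by
  rw [polarPoint_mem_ribbon_iff hε1 hs, invRadius_even, invRadius_even]
  rintro ⟨-, h2⟩
  rw [mul_one_div, lt_div_iff₀ (by linarith)] at h2
  linarith

lemma polarPoint_notMem_ribbon_of_odd {ε : ℝ} (hε1 : ε < 1) (k : ℕ) {s : ℝ}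
    (h : 1 ≤ s) (m : ℤ) :
    polarPoint s ((2 * m + 1) * halfStep k) ∉ ribbon ε k := by
  rw [polarPoint_mem_ribbon_iff hε1 (by linarith), invRadius_odd, invRadius_odd]
  rintro ⟨h1, -⟩
  linarith

/-- Interpolating linearly between the two reciprocal radii parametrises the ribbon by the connected
strip $\mathbb R\times(0,1)$; letting the angle run over all of $\mathbb R$ again makes the branch
cut irrelevant. -/
lemma isConnected_ribbon {ε : ℝ} (hε : 0 < ε) (hε1 : ε < 1) (k : ℕ) :
    IsConnected (ribbon ε k) := by
  have hpos1 : ∀ θ, 0 < invRadius k 1 2 θ := fun θ => invRadius_pos k θ one_pos two_pos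
  have hpos2 : ∀ θ, 0 < invRadius k (1 - ε) (2 - ε) θ :=
    fun θ => invRadius_pos k θ (by linarith) (by linarith)
  have hlt : ∀ θ, invRadius k 1 2 θ < invRadius k (1 - ε) (2 - ε) θ :=
    fun θ => invRadius_lt_invRadius k θ (by linarith) (by linarith) (by linarith) (by linarith)
  have heq : ribbon ε k = (fun q : ℝ × ℝ => polarPoint
      (1 / ((1 - q.2) * invRadius k 1 2 q.1 + q.2 * invRadius k (1 - ε) (2 - ε) q.1)) q.1) ''
        (univ ×ˢ Ioo 0 1) := by
    ext z
    constructor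
    · intro hz
      have h0 : z ≠ 0 := fun h => zero_notMem_ribbon hε1 k (h ▸ hz)
      have hn : 0 < ‖z‖ := norm_pos_iff.mpr h0
      rw [← polarPoint_norm_arg z, polarPoint_mem_ribbon_iff hε1 hn] at hz
      have := hlt z.arg
      set A := invRadius k 1 2 z.arg with hA
      set B := invRadius k (1 - ε) (2 - ε) z.arg with hB
      have hz1 : A < 1 / ‖z‖ := by rw [lt_div_iff₀ hn]; linarith [hz.1]
      have hz2 : 1 / ‖z‖ < B := by rw [div_lt_iff₀ hn]; linarith [hz.2]
      have hBA : 0 < B - A := by linarith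
      refine ⟨(z.arg, (1 / ‖z‖ - A) / (B - A)), ⟨mem_univ _, ?_, ?_⟩, ?_⟩
      · exact div_pos (by linarith) hBA
      · rw [div_lt_one hBA]; linarith
      · have : (1 - (1 / ‖z‖ - A) / (B - A)) * A + (1 / ‖z‖ - A) / (B - A) * B = 1 / ‖z‖ := by
          field_simp; ring
        simp only [← hA, ← hB, this, one_div_one_div, polarPoint_norm_arg]
    · rintro ⟨⟨θ, t⟩, ⟨-, ht⟩, rfl⟩
      have h1 := hpos1 θ
      have h2 := hpos2 θ
      have h3 := hlt θ
      simp only [mem_Ioo] at ht ⊢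
      set A := invRadius k 1 2 θ with hA
      set B := invRadius k (1 - ε) (2 - ε) θ with hB
      have hc1 : A < (1 - t) * A + t * B := by nlinarith
      have hc2 : (1 - t) * A + t * B < B := by nlinarith
      have hc : 0 < (1 - t) * A + t * B := by linarith
      rw [polarPoint_mem_ribbon_iff hε1 (by positivity), ← hA, ← hB, one_div_mul_eq_div,
        one_div_mul_eq_div, div_lt_one hc, one_lt_div hc]
      exact ⟨hc1, hc2⟩
  rw [heq]
  refine IsConnected.image (isConnected_univ.prod (isConnected_Ioo zero_lt_one)) _ ?_
  have c1 := (continuous_invRadius k 1 2).comp (continuous_fst (X := ℝ) (Y := ℝ))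
  have c2 := (continuous_invRadius k (1 - ε) (2 - ε)).comp (continuous_fst (X := ℝ) (Y := ℝ))
  have c3 : Continuous fun q : ℝ × ℝ =>
      (1 - q.2) * invRadius k 1 2 q.1 + q.2 * invRadius k (1 - ε) (2 - ε) q.1 :=
    ((continuous_const.sub continuous_snd).mul c1).add (continuous_snd.mul c2)
  have c4 : ContinuousOn (fun q : ℝ × ℝ => 1 / ((1 - q.2) * invRadius k 1 2 q.1
      + q.2 * invRadius k (1 - ε) (2 - ε) q.1)) (univ ×ˢ Ioo 0 1) := by
    refine continuousOn_const.div c3.continuousOn ?_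
    rintro ⟨θ, t⟩ ⟨-, ht⟩
    have h1 := hpos1 θ
    have h2 := hpos2 θ
    have h3 : 0 < 1 - t := by linarith [ht.2]
    have h4 : 0 < t := ht.1
    positivity
  exact (Complex.continuous_ofReal.comp_continuousOn c4).mul
    (Continuous.continuousOn (by fun_prop))

lemma norm_lt_of_mem_ribbon {ε : ℝ} {k : ℕ} {z : ℂ} (hz : z ∈ ribbon ε k) :
    ‖z‖ < 2 := by
  obtain ⟨⟨p, hp, t, ht0, ht1, rfl⟩, -⟩ := hz
  have hp2 : ‖p‖ ≤ 2 := by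
    rw [mem_zigzag_iff] at hp
    have key : ∀ a b x y : ℝ, 0 ≤ a → 0 ≤ b → a + b = 1 →
        ‖polarPoint (a * 2) x + polarPoint (b * 1) y‖ ≤ 2 := by
      intro a b x y ha hb hab
      refine (norm_add_le _ _).trans ?_
      rw [norm_polarPoint (by positivity), norm_polarPoint (by positivity)]
      linarith
    obtain ⟨m, a, b, ha, hb, hab, rfl | rfl⟩ := hp <;> exact key _ _ _ _ ha hb hab
  rw [norm_smul, Real.norm_eq_abs, abs_of_nonneg ht0]
  nlinarith [norm_nonneg p]

lemma ribbon_subset_ball (ε : ℝ) (k : ℕ) : ribbon ε k ⊆ Metric.ball 0 2 :=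
  fun _ hz => by simpa using norm_lt_of_mem_ribbon hz

lemma crossRadius_ribbon {ε : ℝ} (hε : 0 < ε) (hε1 : ε < 1) (k : ℕ) :
    crossRadius (ribbon ε k) = 2 := by
  apply csSup_eq_of_forall_le_of_forall_lt_exists_gt
  · exact (isConnected_ribbon hε hε1 k).nonempty.image _
  · rintro _ ⟨z, hz, rfl⟩
    exact (norm_lt_of_mem_ribbon hz).le
  · intro w hw
    set s := (max w (2 - ε) + 2) / 2 with hs
    have h1 : max w (2 - ε) < 2 := max_lt hw (by linarith)
    have h2 : w < s := by linarith [le_max_left w (2 - ε)]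
    have h3 : 2 - ε < s := by linarith [le_max_right w (2 - ε)]
    exact ⟨s, ⟨_, polarPoint_mem_ribbon_of_even hε1 k h3 (by linarith) 0,
      norm_polarPoint (by linarith) _⟩, h2⟩

lemma isTubeCrossSection_ribbon {ε : ℝ} (hε : 0 < ε) (hε1 : ε < 1) (k : ℕ) :
    IsTubeCrossSection (ribbon ε k) := by
  refine ⟨isOpen_ribbon hε1 k, Metric.isBounded_ball.subset (ribbon_subset_ball ε k),
    isConnected_ribbon hε hε1 k, fun h => ?_⟩
  -- Rotation by half a step carries a ribbon point on an outer ray, of radius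
  -- $2-\varepsilon/2\ge1$, to an inner ray, where no point of the ribbon has such a radius.
  have h1 := h (polarPoint 1 (halfStep k)) (norm_polarPoint zero_le_one _)
  have h2 : polarPoint (2 - ε / 2) (2 * (0 : ℤ) * halfStep k) ∈ ribbon ε k :=
    polarPoint_mem_ribbon_of_even hε1 k (by linarith) (by linarith) 0
  have h3 := mem_image_of_mem (fun z => polarPoint 1 (halfStep k) * z) h2
  rw [h1] at h3
  have h4 := polarPoint_notMem_ribbon_of_odd hε1 k (s := 2 - ε / 2) (by linarith) 0
  apply h4
  convert h3 using 1
  simp [polarPoint]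
  ring

lemma ediam_ribbon_le (ε : ℝ) (k : ℕ) : Metric.ediam (ribbon ε k) ≤ 4 := by
  apply Metric.ediam_le
  intro x hx y hy
  rw [edist_dist, show (4 : ℝ≥0∞) = ENNReal.ofReal 4 by simp]
  apply ENNReal.ofReal_le_ofReal
  rw [dist_eq_norm]
  linarith [norm_sub_le x y, norm_lt_of_mem_ribbon hx, norm_lt_of_mem_ribbon hy]

lemma volume_ribbon_le (ε : ℝ) (k : ℕ) :
    volume (ribbon ε k) ≤ ENNReal.ofReal (4 * Real.pi) := by
  refine (measure_mono (ribbon_subset_ball ε k)).trans ?_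
  rw [Complex.volume_ball, ENNReal.ofReal_mul (by norm_num), ← ENNReal.ofReal_pow (by norm_num)]
  apply le_of_eq
  congr 1
  · norm_num
  · rw [← NNReal.coe_real_pi, ENNReal.ofReal_coe_nnreal]

/-! ### A Poincaré inequality for the angular derivative -/

/-- The function $g=-\kappa\tan(\kappa(x-\text{midpoint}))$ solves the Riccati equation
$g'=-(\kappa^2+g^2)$. Expanding $\int(v'-gv)^2\ge0$ leaves $\int v'^2-\kappa^2\int v^2$ minus the
integral of $(gv^2)'$, which vanishes by the boundary values. The strict inequality $\kappa\ell<\pi$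
keeps $g$ regular on the closed interval. -/
lemma poincare_interval {v v' : ℝ → ℝ} (hv : ∀ x, HasDerivAt v (v' x) x) (hv' : Continuous v')
    {κ ℓ a : ℝ} (hκ : 0 < κ) (hℓ : 0 ≤ ℓ) (hκℓ : κ * ℓ < Real.pi) (ha : v a = 0)
    (hb : v (a + ℓ) = 0) :
    κ ^ 2 * ∫ x in a..a + ℓ, v x ^ 2 ≤ ∫ x in a..a + ℓ, v' x ^ 2 := by
  have hvc : Continuous v := continuous_iff_continuousAt.mpr fun x => (hv x).continuousAt
  have hab : a ≤ a + ℓ := by linarith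
  have hcos : ∀ x ∈ Icc a (a + ℓ), Real.cos (κ * (x - (a + ℓ / 2))) ≠ 0 := by
    intro x hx
    apply (Real.cos_pos_of_mem_Ioo ⟨?_, ?_⟩).ne'
    · nlinarith [hx.1]
    · nlinarith [hx.2]
  have hcont : ContinuousOn (fun x => Real.tan (κ * (x - (a + ℓ / 2)))) (uIcc a (a + ℓ)) := by
    rw [uIcc_of_le hab]
    intro x hx
    exact (ContinuousAt.comp (f := fun x => κ * (x - (a + ℓ / 2)))
      (Real.continuousAt_tan.mpr (hcos x hx)) (by fun_prop)).continuousWithinAt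
  set g : ℝ → ℝ := fun x => -κ * Real.tan (κ * (x - (a + ℓ / 2))) with hg
  have hgcont : ContinuousOn g (uIcc a (a + ℓ)) := continuousOn_const.mul hcont
  have hgd : ∀ x ∈ uIcc a (a + ℓ), HasDerivAt g (-(κ ^ 2 + g x ^ 2)) x := by
    intro x hx
    rw [uIcc_of_le hab] at hx
    have h1 : HasDerivAt (fun x => κ * (x - (a + ℓ / 2))) κ x := by
      simpa using ((hasDerivAt_id x).sub_const (a + ℓ / 2)).const_mul κ
    have h2 := ((Real.hasDerivAt_tan (hcos x hx)).comp x h1).const_mul (-κ)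
    refine h2.congr_deriv ?_
    have h3 := hcos x hx
    have := Real.sin_sq_add_cos_sq (κ * (x - (a + ℓ / 2)))
    simp only [hg]
    rw [Real.tan_eq_sin_div_cos]
    generalize κ * (x - (a + ℓ / 2)) = y at h3 this ⊢
    field_simp
    linear_combination this
  have hG : ∫ x in a..a + ℓ, (-(κ ^ 2 + g x ^ 2) * v x ^ 2 + g x * (2 * v x * v' x)) = 0 := by
    rw [intervalIntegral.integral_eq_sub_of_hasDerivAt (f := fun x => g x * v x ^ 2)]
    · simp [ha, hb]
    · intro x hx
      refine ((hgd x hx).mul ((hv x).pow 2)).congr_deriv ?_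
      simp
    · apply ContinuousOn.intervalIntegrable
      have := hvc.continuousOn (s := uIcc a (a + ℓ))
      have := hv'.continuousOn (s := uIcc a (a + ℓ))
      fun_prop
  have hpos : 0 ≤ ∫ x in a..a + ℓ, (v' x - g x * v x) ^ 2 :=
    intervalIntegral.integral_nonneg hab fun x _ => sq_nonneg _
  have hsplit : ∫ x in a..a + ℓ, (v' x - g x * v x) ^ 2
      = (∫ x in a..a + ℓ, v' x ^ 2) - κ ^ 2 * (∫ x in a..a + ℓ, v x ^ 2)
        - ∫ x in a..a + ℓ, (-(κ ^ 2 + g x ^ 2) * v x ^ 2 + g x * (2 * v x * v' x)) := by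
    have c1 := hvc.continuousOn (s := uIcc a (a + ℓ))
    have c2 := hv'.continuousOn (s := uIcc a (a + ℓ))
    rw [← intervalIntegral.integral_const_mul, ← intervalIntegral.integral_sub,
      ← intervalIntegral.integral_sub]
    · congr 1; ext x; ring
    all_goals
      apply ContinuousOn.intervalIntegrable
      fun_prop
  linarith

lemma poincare_iterate {v v' : ℝ → ℝ} (hv : ∀ x, HasDerivAt v (v' x) x) (hv' : Continuous v')
    {κ ℓ a : ℝ} (hκ : 0 < κ) (hℓ : 0 ≤ ℓ) (hκℓ : κ * ℓ < Real.pi)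
    (hz : ∀ n : ℕ, v (a + n * ℓ) = 0) (n : ℕ) :
    κ ^ 2 * ∫ x in a..a + n * ℓ, v x ^ 2 ≤ ∫ x in a..a + n * ℓ, v' x ^ 2 := by
  have hvc : Continuous v := continuous_iff_continuousAt.mpr fun x => (hv x).continuousAt
  induction n with
  | zero => simp
  | succ n ih =>
    have h1 := poincare_interval hv hv' hκ hℓ hκℓ (hz n)
      (by rw [← hz (n + 1)]; push_cast; ring_nf)
    have he : a + n * ℓ + ℓ = a + (n + 1 : ℕ) * ℓ := by push_cast; ring
    rw [he] at h1
    rw [← intervalIntegral.integral_add_adjacent_intervals (b := a + n * ℓ)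
      (f := fun x => v x ^ 2) ((hvc.pow 2).intervalIntegrable _ _)
      ((hvc.pow 2).intervalIntegrable _ _),
      ← intervalIntegral.integral_add_adjacent_intervals (b := a + n * ℓ)
      (f := fun x => v' x ^ 2) ((hv'.pow 2).intervalIntegrable _ _)
      ((hv'.pow 2).intervalIntegrable _ _), mul_add]
    exact add_le_add ih h1

lemma hasDerivAt_polarPoint (s θ : ℝ) :
    HasDerivAt (polarPoint s) (Complex.I * polarPoint s θ) θ := by
  unfold polarPoint
  have h1 : HasDerivAt (fun θ : ℝ => (θ : ℂ) * Complex.I) (1 * Complex.I) θ :=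
    (Complex.ofRealCLM.hasDerivAt (x := θ)).mul_const _
  have h2 := (h1.cexp).const_mul (s : ℂ)
  refine h2.congr_deriv ?_
  ring

lemma continuous_angDeriv {u : ℂ → ℝ} (hu : ContDiff ℝ 1 u) : Continuous (angDeriv u) := by
  unfold angDeriv
  exact (hu.continuous_fderiv one_ne_zero).clm_apply (by fun_prop)

lemma poincare_circle {ε : ℝ} (hε1 : ε < 1) {k : ℕ} {u : ℂ → ℝ} (hu : ContDiff ℝ 1 u)
    (hsupp : ∀ z ∉ ribbon ε k, u z = 0) {κ : ℝ} (hκ : 0 < κ)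
    (hκd : κ * (2 * halfStep k) < Real.pi) {s : ℝ} (hs : 0 < s) :
    κ ^ 2 * ∫ θ in -Real.pi..Real.pi, u (polarPoint s θ) ^ 2 ≤
      ∫ θ in -Real.pi..Real.pi, angDeriv u (polarPoint s θ) ^ 2 := by
  have hpc : Continuous (polarPoint s) := by unfold polarPoint; fun_prop
  have hv : ∀ θ, HasDerivAt (fun θ => u (polarPoint s θ)) (angDeriv u (polarPoint s θ)) θ :=
    fun θ => ((hu.differentiable one_ne_zero).differentiableAt.hasFDerivAt
      (x := polarPoint s θ)).comp_hasDerivAt θ (hasDerivAt_polarPoint s θ)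
  have hv' : Continuous fun θ => angDeriv u (polarPoint s θ) := (continuous_angDeriv hu).comp hpc
  have hper : Function.Periodic (polarPoint s) (2 * Real.pi) := fun θ => by
    simpa using polarPoint_add_int s θ 1
  -- The folding enters here: circles of radius at least $1$ leave the ribbon on the inner rays;
  -- smaller ones do so on the outer rays, because $1\le2-\varepsilon$.
  obtain ⟨a, ha⟩ : ∃ a : ℝ, ∀ n : ℕ, u (polarPoint s (a + n * (2 * halfStep k))) = 0 := by
    rcases le_total 1 s with h | h
    · refine ⟨halfStep k, fun n => hsupp _ ?_⟩
      have := polarPoint_notMem_ribbon_of_odd hε1 k h n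
      convert this using 2
      push_cast; ring_nf
    · refine ⟨0, fun n => hsupp _ ?_⟩
      have := polarPoint_notMem_ribbon_of_even hε1 k hs (by linarith) n
      convert this using 2
      push_cast; ring_nf
  -- These $2^{k+1}$ arcs of angle $2\delta_k$ fill one full turn, which periodicity then moves to
  -- $[-\pi,\pi]$.
  have h1 := poincare_iterate hv hv' hκ (by linarith [halfStep_pos k]) hκd ha (2 ^ (k + 1))
  have h2 : a + ((2 ^ (k + 1) : ℕ) : ℝ) * (2 * halfStep k) = a + 2 * Real.pi := by
    push_cast
    linear_combination 2 * two_pow_mul_halfStep k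
  have hshift : ∀ g : ℂ → ℝ, ∫ θ in -Real.pi..Real.pi, g (polarPoint s θ) =
      ∫ θ in a..a + 2 * Real.pi, g (polarPoint s θ) := by
    intro g
    have := (hper.comp g).intervalIntegral_add_eq (-Real.pi) a
    simp only [Function.comp_apply] at this
    rw [← this]
    congr 1; ring
  rw [h2] at h1
  rwa [hshift fun z => u z ^ 2, hshift fun z => angDeriv u z ^ 2]

lemma lintegral_eq_polar {g : ℂ → ℝ≥0∞} (hg : Measurable g) :
    ∫⁻ z, g z = ∫⁻ s in Ioi (0 : ℝ), ENNReal.ofReal s *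
      ∫⁻ θ in Ioo (-Real.pi) Real.pi, g (polarPoint s θ) := by
  have hp : Continuous fun p : ℝ × ℝ => polarPoint p.1 p.2 := by unfold polarPoint; fun_prop
  rw [← Complex.lintegral_comp_polarCoord_symm g]
  have h1 : ∀ p : ℝ × ℝ, Complex.polarCoord.symm p = polarPoint p.1 p.2 := fun p => by
    rw [Complex.polarCoord_symm_apply, polarPoint, Complex.exp_mul_I]
    push_cast; ring
  simp only [h1, smul_eq_mul]
  rw [show polarCoord.target = Ioi (0 : ℝ) ×ˢ Ioo (-Real.pi) Real.pi from rfl,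
    Measure.volume_eq_prod, ← Measure.prod_restrict, lintegral_prod]
  · refine lintegral_congr fun s => ?_
    simp only
    rw [lintegral_const_mul]
    exact hg.comp (hp.comp (by fun_prop : Continuous fun θ : ℝ => (s, θ))).measurable
  · exact ((ENNReal.measurable_ofReal.comp measurable_fst).mul
      (hg.comp hp.measurable)).aemeasurable

lemma ofReal_intervalIntegral {g : ℝ → ℝ} (hg : Continuous g) (h0 : ∀ x, 0 ≤ g x) {a b : ℝ}
    (hab : a ≤ b) :
    ∫⁻ θ in Ioo a b, ENNReal.ofReal (g θ) = ENNReal.ofReal (∫ θ in a..b, g θ) := by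
  rw [intervalIntegral.integral_of_le hab, integral_Ioc_eq_integral_Ioo,
    ofReal_integral_eq_lintegral_ofReal]
  · exact (hg.integrableOn_Icc (a := a) (b := b)).mono_set Ioo_subset_Icc_self
  · exact Eventually.of_forall h0

lemma angDeriv_eq_zero_of_notMem {u : ℂ → ℝ} {z : ℂ} (hz : z ∉ tsupport u) :
    angDeriv u z = 0 := by
  have : fderiv ℝ u z = 0 :=
    image_eq_zero_of_notMem_tsupport fun h => hz (tsupport_fderiv_subset ℝ h)
  simp [angDeriv, this]

/-- The operator $\partial_\alpha$ is the pure derivative in $\theta$, without a factor $1/s$, so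
the inequality on circles integrates against $s\,ds$ with the same constant. Extended nonnegative
integrals allow Tonelli in polar coordinates. -/
lemma poincare_ribbon {ε : ℝ} (hε1 : ε < 1) {k : ℕ} {u : ℂ → ℝ} (hu : ContDiff ℝ 1 u)
    (hc : HasCompactSupport u) (hsupp : tsupport u ⊆ ribbon ε k) {κ : ℝ} (hκ : 0 < κ)
    (hκd : κ * (2 * halfStep k) < Real.pi) :
    κ ^ 2 * ∫ z, u z ^ 2 ≤ ∫ z, angDeriv u z ^ 2 := by
  have hsupp' : ∀ z ∉ ribbon ε k, u z = 0 := fun z hz =>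
    image_eq_zero_of_notMem_tsupport fun h => hz (hsupp h)
  have hcA : HasCompactSupport (angDeriv u) :=
    HasCompactSupport.of_support_subset_isCompact hc fun z hz => by
      by_contra h; exact hz (angDeriv_eq_zero_of_notMem h)
  have cu := hu.continuous
  have cA := continuous_angDeriv hu
  have i1 : Integrable fun z => κ ^ 2 * u z ^ 2 :=
    (by fun_prop : Continuous fun z => κ ^ 2 * u z ^ 2).integrable_of_hasCompactSupport
      (hc.comp_left (g := fun x => κ ^ 2 * x ^ 2) (by simp))
  have i2 : Integrable fun z => angDeriv u z ^ 2 :=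
    (by fun_prop : Continuous fun z => angDeriv u z ^ 2).integrable_of_hasCompactSupport
      (hcA.comp_left (g := fun x => x ^ 2) (by simp))
  rw [← integral_const_mul, ← ENNReal.ofReal_le_ofReal_iff (integral_nonneg fun z => sq_nonneg _),
    ofReal_integral_eq_lintegral_ofReal i1 (Eventually.of_forall fun z => by positivity),
    ofReal_integral_eq_lintegral_ofReal i2 (Eventually.of_forall fun z => by positivity),
    lintegral_eq_polar (by fun_prop), lintegral_eq_polar (by fun_prop)]
  refine setLIntegral_mono' measurableSet_Ioi fun s hs => ?_
  gcongr ENNReal.ofReal s * ?_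
  have hpc : Continuous (polarPoint s) := by unfold polarPoint; fun_prop
  rw [ofReal_intervalIntegral (g := fun θ => κ ^ 2 * u (polarPoint s θ) ^ 2) (by fun_prop)
      (fun _ => by positivity) (by linarith [Real.pi_pos]),
    ofReal_intervalIntegral (g := fun θ => angDeriv u (polarPoint s θ) ^ 2) (by fun_prop)
      (fun _ => by positivity) (by linarith [Real.pi_pos]), intervalIntegral.integral_const_mul]
  exact ENNReal.ofReal_le_ofReal (poincare_circle hε1 hu hsupp' hκ hκd hs)

/-! ### Cut-offs adapted to the ground state -/

/-- A smooth step from `0` on `(-∞, 1/4]` to `1` on `[3/4, ∞)`. -/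
def smoothStep (t : ℝ) : ℝ := Real.smoothTransition (2 * t - 1 / 2)

lemma contDiff_smoothStep : ContDiff ℝ 2 smoothStep :=
  (Real.smoothTransition.contDiff (n := 2)).comp (by fun_prop)

lemma smoothStep_of_le {t : ℝ} (h : t ≤ 1 / 4) : smoothStep t = 0 :=
  Real.smoothTransition.zero_of_nonpos (by linarith)

lemma smoothStep_of_ge {t : ℝ} (h : 3 / 4 ≤ t) : smoothStep t = 1 :=
  Real.smoothTransition.one_of_one_le (by linarith)

lemma deriv_smoothStep_of_lt {t : ℝ} (h : t < 1 / 4) : deriv smoothStep t = 0 := by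
  have : smoothStep =ᶠ[𝓝 t] fun _ => 0 := by
    filter_upwards [Iio_mem_nhds h] with x hx using smoothStep_of_le hx.le
  rw [this.deriv_eq, deriv_const]

lemma deriv_smoothStep_of_gt {t : ℝ} (h : 3 / 4 < t) : deriv smoothStep t = 0 := by
  have : smoothStep =ᶠ[𝓝 t] fun _ => 1 := by
    filter_upwards [Ioi_mem_nhds h] with x hx using smoothStep_of_ge hx.le
  rw [this.deriv_eq, deriv_const]

lemma continuous_deriv_smoothStep : Continuous (deriv smoothStep) :=
  contDiff_smoothStep.continuous_deriv one_le_two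

/-- The derivative vanishes outside $[1/4,3/4]$, where $(1-t)^2\le1$, so one bound serves both
purposes. The second bound supplies the dominating function in `exists_cutoff`. -/
lemma exists_deriv_smoothStep_le :
    ∃ B : ℝ, 0 ≤ B ∧ (∀ t, deriv smoothStep t ^ 2 ≤ B) ∧
      ∀ t, deriv smoothStep t ^ 2 * (1 - t) ^ 2 ≤ B := by
  obtain ⟨B, hB⟩ := isCompact_Icc.bddAbove_image
    ((continuous_deriv_smoothStep.pow 2).continuousOn (s := Icc (1 / 4 : ℝ) (3 / 4)))
  have h1 : ∀ t ∈ Icc (1 / 4 : ℝ) (3 / 4), deriv smoothStep t ^ 2 ≤ B := fun t ht =>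
    hB (mem_image_of_mem _ ht)
  have hB0 : 0 ≤ B := (sq_nonneg _).trans (h1 (1 / 4) ⟨le_rfl, by norm_num⟩)
  refine ⟨B, hB0, fun t => ?_, fun t => ?_⟩ <;>
  · rcases lt_or_ge t (1 / 4) with h | h
    · simpa [deriv_smoothStep_of_lt h] using hB0
    rcases lt_or_ge (3 / 4) t with h' | h'
    · simpa [deriv_smoothStep_of_gt h'] using hB0
    have := h1 t ⟨h, h'⟩
    have h2 : (1 - t) ^ 2 ≤ 1 := by nlinarith
    nlinarith [sq_nonneg (deriv smoothStep t), sq_nonneg (1 - t)]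

lemma gradSq_nonneg {F : Type*} [NormedAddCommGroup F] [NormedSpace ℝ F] (u : ℂ → F) (z : ℂ) :
    0 ≤ gradSq u z := by unfold gradSq; positivity

lemma gradSq_real (u : ℂ → ℝ) (z : ℂ) :
    gradSq u z = fderiv ℝ u z 1 ^ 2 + fderiv ℝ u z Complex.I ^ 2 := by
  simp [gradSq]

/-- The cut-off `F (g / f)`. -/
def quotientCutoff (g f : ℂ → ℝ) (z : ℂ) : ℝ := smoothStep (g z / f z)

lemma support_quotientCutoff_subset (g f : ℂ → ℝ) :
    Function.support (quotientCutoff g f) ⊆ Function.support g := by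
  intro z hz
  contrapose! hz
  simp only [Function.mem_support, not_not] at hz ⊢
  rw [quotientCutoff, hz, zero_div, smoothStep_of_le (by norm_num)]

lemma tsupport_quotientCutoff_subset (g f : ℂ → ℝ) :
    tsupport (quotientCutoff g f) ⊆ tsupport g :=
  closure_mono (support_quotientCutoff_subset g f)

lemma contDiff_of_forall_mem_tsupport {n : WithTop ℕ∞} {h : ℂ → ℝ}
    (hh : ∀ z ∈ tsupport h, ContDiffAt ℝ n h z) : ContDiff ℝ n h := by
  refine contDiff_iff_contDiffAt.mpr fun z => ?_
  by_cases hz : z ∈ tsupport h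
  · exact hh z hz
  · exact contDiffAt_const.congr_of_eventuallyEq (notMem_tsupport_iff_eventuallyEq.mp hz)

lemma contDiff_quotientCutoff {Ω : Set ℂ} {g f : ℂ → ℝ} (hg : IsTest Ω g)
    (hf : ∀ z ∈ Ω, ContDiffAt ℝ 2 f z) (hpos : ∀ z ∈ Ω, 0 < f z) :
    ContDiff ℝ 2 (quotientCutoff g f) := by
  refine contDiff_of_forall_mem_tsupport fun z hz => ?_
  have hzΩ := hg.2.2 (tsupport_quotientCutoff_subset g f hz)
  have h1 : ContDiffAt ℝ 2 g z :=
    (hg.1.of_le (WithTop.coe_le_coe.mpr (le_top : (2 : ℕ∞) ≤ ⊤))).contDiffAt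
  exact contDiff_smoothStep.contDiffAt.comp z (h1.div (hf z hzΩ) (hpos z hzΩ).ne')

/-- With $t=g/f$ one has $f\nabla F(g/f)=F'(t)\bigl(\nabla(g-f)+(1-t)\nabla f\bigr)$. The first term
is controlled by $H^1$ convergence; the second tends to zero pointwise when $t\to1$ and is dominated
by $|\nabla f|$. -/
lemma gradSq_quotientCutoff_le {B : ℝ} (hB : ∀ t, deriv smoothStep t ^ 2 ≤ B)
    {g f : ℂ → ℝ} {z : ℂ} (hg : DifferentiableAt ℝ g z) (hf : DifferentiableAt ℝ f z)
    (hpos : 0 < f z) :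
    f z ^ 2 * gradSq (quotientCutoff g f) z ≤
      2 * B * gradSq (fun w => g w - f w) z
        + 2 * (deriv smoothStep (g z / f z) ^ 2 * (1 - g z / f z) ^ 2) * gradSq f z := by
  have hq : HasFDerivAt (fun w => g w / f w)
      ((f z ^ 2)⁻¹ • (f z • fderiv ℝ g z - g z • fderiv ℝ f z)) z := by
    have := hg.hasFDerivAt.mul ((hasDerivAt_inv hpos.ne').comp_hasFDerivAt z hf.hasFDerivAt)
    refine this.congr_fderiv ?_
    ext v
    simp
    field_simp
    ring
  have hd : HasFDerivAt (quotientCutoff g f) (deriv smoothStep (g z / f z) •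
      ((f z ^ 2)⁻¹ • (f z • fderiv ℝ g z - g z • fderiv ℝ f z))) z :=
    ((contDiff_smoothStep.differentiable two_ne_zero).differentiableAt.hasDerivAt
      (x := g z / f z)).comp_hasFDerivAt z hq
  have hsub : fderiv ℝ (fun w => g w - f w) z = fderiv ℝ g z - fderiv ℝ f z :=
    fderiv_fun_sub hg hf
  rw [gradSq_real, gradSq_real, gradSq_real, hd.fderiv, hsub]
  have key : ∀ v : ℂ, f z ^ 2 * ((deriv smoothStep (g z / f z) •
      ((f z ^ 2)⁻¹ • (f z • fderiv ℝ g z - g z • fderiv ℝ f z))) v) ^ 2 ≤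
      2 * B * ((fderiv ℝ g z - fderiv ℝ f z) v) ^ 2
        + 2 * (deriv smoothStep (g z / f z) ^ 2 * (1 - g z / f z) ^ 2) * (fderiv ℝ f z v) ^ 2 := by
    intro v
    set D := deriv smoothStep (g z / f z)
    have e1 : f z ^ 2 * ((D • ((f z ^ 2)⁻¹ • (f z • fderiv ℝ g z - g z • fderiv ℝ f z))) v) ^ 2
        = D ^ 2 * ((fderiv ℝ g z - fderiv ℝ f z) v + (1 - g z / f z) * fderiv ℝ f z v) ^ 2 := by
      simp
      field_simp
      ring
    rw [e1]
    have hb := hB (g z / f z)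
    change D ^ 2 ≤ B at hb
    set X := (fderiv ℝ g z - fderiv ℝ f z) v
    set Y := (1 - g z / f z) * fderiv ℝ f z v with hY
    have e2 : 2 * (D ^ 2 * (1 - g z / f z) ^ 2) * (fderiv ℝ f z v) ^ 2 = 2 * D ^ 2 * Y ^ 2 := by
      rw [hY]; ring
    rw [e2]
    have h3 : (X + Y) ^ 2 ≤ 2 * X ^ 2 + 2 * Y ^ 2 := by nlinarith [sq_nonneg (X - Y)]
    calc D ^ 2 * (X + Y) ^ 2 ≤ D ^ 2 * (2 * X ^ 2 + 2 * Y ^ 2) := by gcongr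
      _ = 2 * D ^ 2 * X ^ 2 + 2 * D ^ 2 * Y ^ 2 := by ring
      _ ≤ 2 * B * X ^ 2 + 2 * D ^ 2 * Y ^ 2 := by gcongr
  have k1 := key 1
  have k2 := key Complex.I
  linarith

lemma continuousOn_gradSq {Ω : Set ℂ} {f : ℂ → ℝ} (hf : ∀ z ∈ Ω, ContDiffAt ℝ 1 f z) :
    ContinuousOn (gradSq f) Ω := by
  intro z hz
  have : ContinuousAt (fderiv ℝ f) z := ((hf z hz).fderiv_right (m := 0) (by norm_num)).continuousAt
  unfold gradSq
  have h1 : ContinuousAt (fun z => fderiv ℝ f z 1) z := this.clm_apply continuousAt_const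
  have h2 : ContinuousAt (fun z => fderiv ℝ f z Complex.I) z := this.clm_apply continuousAt_const
  exact ((h1.norm.pow 2).add (h2.norm.pow 2)).continuousWithinAt

lemma gradSq_eq_zero_of_notMem {u : ℂ → ℝ} {z : ℂ} (hz : z ∉ tsupport u) : gradSq u z = 0 := by
  have : fderiv ℝ u z = 0 :=
    image_eq_zero_of_notMem_tsupport fun h => hz (tsupport_fderiv_subset ℝ h)
  simp [gradSq, this]

lemma integrable_of_continuous_of_tsupport {h : ℂ → ℝ} {K : Set ℂ} (hK : IsCompact K)
    (hc : Continuous h) (h0 : ∀ z ∉ K, h z = 0) : Integrable h :=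
  hc.integrable_of_hasCompactSupport (HasCompactSupport.of_support_subset_isCompact hK
    fun z hz => by by_contra h; exact hz (h0 z h))

lemma lintegral_gradSq_lt_top {Ω : Set ℂ} {g : ℂ → ℝ} (hg : IsTest Ω g) :
    ∫⁻ z in Ω, ENNReal.ofReal (gradSq g z) < ⊤ := by
  have h1 : Integrable (gradSq g) := by
    apply integrable_of_continuous_of_tsupport hg.2.1
    · rw [← continuousOn_univ]
      exact continuousOn_gradSq fun z _ => (hg.1.of_le (by exact_mod_cast le_top)).contDiffAt
    · exact fun z hz => gradSq_eq_zero_of_notMem hz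
  exact (h1.integrableOn (s := Ω)).lintegral_lt_top

lemma lintegral_gradSq_lt_top_of_memH10 {Ω : Set ℂ} (hΩ : IsOpen Ω) {f : ℂ → ℝ}
    (hf : ∀ z ∈ Ω, ContDiffAt ℝ 1 f z) (H : MemH10 Ω f) :
    ∫⁻ z in Ω, ENNReal.ofReal (gradSq f z) < ⊤ := by
  obtain ⟨g, hg, -, hgrad⟩ := H
  obtain ⟨n, hn⟩ := (hgrad.eventually (gt_mem_nhds (zero_lt_one (α := ℝ≥0∞)))).exists
  have hgd : ∀ z, DifferentiableAt ℝ (g n) z := fun z =>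
    ((hg n).1.differentiable (by simp)).differentiableAt
  have hle : ∀ z ∈ Ω, ENNReal.ofReal (gradSq f z) ≤
      2 * ENNReal.ofReal (gradSq (fun w => g n w - f w) z) + 2 * ENNReal.ofReal (gradSq (g n) z) := by
    intro z hz
    have hfd := (hf z hz).differentiableAt one_ne_zero
    rw [show (2 : ℝ≥0∞) = ENNReal.ofReal 2 by simp, ← ENNReal.ofReal_mul (by norm_num),
      ← ENNReal.ofReal_mul (by norm_num), ← ENNReal.ofReal_add
      (mul_nonneg (by norm_num) (gradSq_nonneg _ _)) (mul_nonneg (by norm_num) (gradSq_nonneg _ _))]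
    apply ENNReal.ofReal_le_ofReal
    rw [gradSq_real, gradSq_real, gradSq_real, fderiv_fun_sub (hgd z) hfd]
    simp only [sub_apply]
    nlinarith [sq_nonneg (fderiv ℝ f z 1 - 2 * fderiv ℝ (g n) z 1),
      sq_nonneg (fderiv ℝ f z Complex.I - 2 * fderiv ℝ (g n) z Complex.I)]
  refine (setLIntegral_mono' hΩ.measurableSet hle).trans_lt ?_
  have hm : Measurable (gradSq (g n)) := by
    apply Continuous.measurable
    rw [← continuousOn_univ]
    exact continuousOn_gradSq fun z _ => ((hg n).1.of_le (by exact_mod_cast le_top)).contDiffAt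
  rw [lintegral_add_right _ (by fun_prop), lintegral_const_mul' _ _ (by simp),
    lintegral_const_mul' _ _ (by simp)]
  exact ENNReal.add_lt_top.mpr ⟨ENNReal.mul_lt_top (by simp) (hn.trans ENNReal.one_lt_top),
    ENNReal.mul_lt_top (by simp) (lintegral_gradSq_lt_top (hg n))⟩

lemma exists_seq_ae_tendsto_of_memH10 {Ω : Set ℂ} (hΩ : IsOpen Ω) {f : ℂ → ℝ}
    (hf : ContinuousOn f Ω) (H : MemH10 Ω f) :
    ∃ g : ℕ → ℂ → ℝ, (∀ n, IsTest Ω (g n)) ∧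
      (∀ᵐ z ∂volume.restrict Ω, Tendsto (fun n => g n z) atTop (𝓝 (f z))) ∧
      Tendsto (fun n => ∫⁻ z in Ω, ENNReal.ofReal (gradSq (fun w => g n w - f w) z)) atTop
        (𝓝 0) := by
  obtain ⟨g, hg, hL2, hgrad⟩ := H
  have hfm : AEStronglyMeasurable f (volume.restrict Ω) :=
    hf.aestronglyMeasurable hΩ.measurableSet
  have hm : ∀ n, AEStronglyMeasurable (fun z => (g n z - f z) ^ 2) (volume.restrict Ω) :=
    fun n => ((hg n).1.continuous.aestronglyMeasurable.sub hfm).pow 2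
  have hT : TendstoInMeasure (volume.restrict Ω) (fun n z => (g n z - f z) ^ 2) atTop
      (fun _ => (0 : ℝ)) := by
    refine tendstoInMeasure_of_tendsto_eLpNorm one_ne_zero hm aestronglyMeasurable_const ?_
    refine hL2.congr fun n => ?_
    rw [eLpNorm_one_eq_lintegral_enorm]
    refine lintegral_congr fun z => ?_
    simp only [Pi.sub_apply, sub_zero]
    rw [Real.enorm_eq_ofReal (sq_nonneg _)]
  obtain ⟨ns, hns, hae⟩ := hT.exists_seq_tendsto_ae
  refine ⟨fun n => g (ns n), fun n => hg _, ?_, hgrad.comp hns.tendsto_atTop⟩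
  filter_upwards [hae] with z hz
  have h1 : Tendsto (fun i => |g (ns i) z - f z|) atTop (𝓝 0) := by
    have := (Real.continuous_sqrt.tendsto 0).comp hz
    simpa [Function.comp_def, Real.sqrt_sq_eq_abs] using this
  exact tendsto_sub_nhds_zero_iff.mp ((tendsto_zero_iff_abs_tendsto_zero _).mpr h1)

lemma exists_cutoff {Ω : Set ℂ} (hΩ : IsOpen Ω) (hne : Ω.Nonempty) {f : ℂ → ℝ}
    (hf : ∀ z ∈ Ω, ContDiffAt ℝ 2 f z) (hpos : ∀ z ∈ Ω, 0 < f z) (H : MemH10 Ω f)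
    {ξ : ℝ} (hξ : 0 < ξ) :
    ∃ φ : ℂ → ℝ, ContDiff ℝ 2 φ ∧ HasCompactSupport φ ∧ tsupport φ ⊆ Ω ∧
      0 < ∫ z, (f z * φ z) ^ 2 ∧
      ∫ z, f z ^ 2 * gradSq φ z ≤ ξ * ∫ z, (f z * φ z) ^ 2 := by
  have hf1 : ∀ z ∈ Ω, ContDiffAt ℝ 1 f z := fun z hz => (hf z hz).of_le one_le_two
  have hfc : ContinuousOn f Ω := fun z hz => (hf z hz).continuousAt.continuousWithinAt
  have hfin := lintegral_gradSq_lt_top_of_memH10 hΩ hf1 H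
  obtain ⟨g, hg, hae, hgrad⟩ := exists_seq_ae_tendsto_of_memH10 hΩ hfc H
  obtain ⟨B, hB0, hB1, hB2⟩ := exists_deriv_smoothStep_le
  have hΩm := hΩ.measurableSet
  have hfm : AEMeasurable f (volume.restrict Ω) := hfc.aemeasurable hΩm
  have hgm : ∀ n, AEMeasurable (g n) (volume.restrict Ω) :=
    fun n => (hg n).1.continuous.measurable.aemeasurable
  have hgfm : AEMeasurable (gradSq f) (volume.restrict Ω) :=
    (continuousOn_gradSq hf1).aemeasurable hΩm
  have hq : ∀ᵐ z ∂volume.restrict Ω, Tendsto (fun n => g n z / f z) atTop (𝓝 1) := by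
    filter_upwards [hae, ae_restrict_mem hΩm] with z hz hzΩ
    have := hz.div_const (f z)
    rwa [div_self (hpos z hzΩ).ne'] at this
  set G : ℝ → ℝ := fun t => 2 * (deriv smoothStep t ^ 2 * (1 - t) ^ 2) with hG
  have hGc : Continuous G := by
    have := continuous_deriv_smoothStep
    fun_prop
  set φ : ℕ → ℂ → ℝ := fun n => quotientCutoff (g n) f with hφ
  have hφc : ∀ n, ContDiff ℝ 2 (φ n) := fun n => contDiff_quotientCutoff (hg n) hf hpos
  have hφs : ∀ n, tsupport (φ n) ⊆ tsupport (g n) := fun n => tsupport_quotientCutoff_subset _ _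
  -- the energies tend to zero
  have hE : Tendsto (fun n => ∫⁻ z in Ω, ENNReal.ofReal (f z ^ 2 * gradSq (φ n) z)) atTop
      (𝓝 0) := by
    have hE2 : Tendsto (fun n => ∫⁻ z in Ω, ENNReal.ofReal (G (g n z / f z) * gradSq f z)) atTop
        (𝓝 (∫⁻ _ in Ω, 0)) := by
      refine tendsto_lintegral_of_dominated_convergence'
        (fun z => ENNReal.ofReal (2 * B) * ENNReal.ofReal (gradSq f z)) (fun n => ?_)
        (fun n => Eventually.of_forall fun z => ?_) ?_ ?_
      · exact ((hGc.measurable.comp_aemeasurable ((hgm n).div hfm)).mul hgfm).ennreal_ofReal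
      · simp only
        rw [← ENNReal.ofReal_mul (by positivity)]
        apply ENNReal.ofReal_le_ofReal
        have := gradSq_nonneg f z
        have h2 := hB2 (g n z / f z)
        simp only [hG]
        gcongr
      · rw [lintegral_const_mul' _ _ ENNReal.ofReal_ne_top]
        exact (ENNReal.mul_lt_top ENNReal.ofReal_lt_top hfin).ne
      · filter_upwards [hq] with z hz
        have h1 := ((hGc.tendsto 1).comp hz).mul_const (gradSq f z)
        have h2 := ENNReal.tendsto_ofReal h1
        simpa [hG] using h2
    have hE1 := ENNReal.Tendsto.const_mul (a := ENNReal.ofReal (2 * B)) hgrad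
      (Or.inr ENNReal.ofReal_ne_top)
    have hsum := hE1.add hE2
    rw [lintegral_zero, mul_zero, add_zero] at hsum
    refine tendsto_of_tendsto_of_tendsto_of_le_of_le tendsto_const_nhds hsum
      (fun _ => zero_le) fun n => ?_
    simp only
    rw [← lintegral_const_mul' _ _ ENNReal.ofReal_ne_top, ← lintegral_add_right']
    · refine setLIntegral_mono' hΩm fun z hz => ?_
      rw [← ENNReal.ofReal_mul (by positivity), ← ENNReal.ofReal_add
        (mul_nonneg (by positivity) (gradSq_nonneg _ _))
        (mul_nonneg (by simp only [hG]; positivity) (gradSq_nonneg _ _))]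
      exact ENNReal.ofReal_le_ofReal (gradSq_quotientCutoff_le hB1
        ((hg n).1.differentiable (by simp)).differentiableAt
        ((hf z hz).differentiableAt two_ne_zero) (hpos z hz))
    · exact ((hGc.measurable.comp_aemeasurable ((hgm n).div hfm)).mul hgfm).ennreal_ofReal
  -- the masses stay away from zero
  have hpos2 : 0 < ∫⁻ z in Ω, ENNReal.ofReal (f z ^ 2) := by
    rw [pos_iff_ne_zero]
    intro h0
    rw [lintegral_eq_zero_iff' (hfm.pow_const 2).ennreal_ofReal] at h0
    have : ∀ᵐ z ∂volume.restrict Ω, False := by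
      filter_upwards [h0, ae_restrict_mem hΩm] with z hz hzΩ
      simp only [Pi.zero_apply, ENNReal.ofReal_eq_zero] at hz
      have := hpos z hzΩ
      exact absurd hz (not_le.mpr (by positivity))
    rw [eventually_false_iff_eq_bot, ae_eq_bot, Measure.restrict_eq_zero] at this
    exact (hΩ.measure_pos volume hne).ne' this
  have hmass : ∫⁻ z in Ω, ENNReal.ofReal (f z ^ 2) ≤
      liminf (fun n => ∫⁻ z in Ω, ENNReal.ofReal ((f z * φ n z) ^ 2)) atTop := by
    refine le_trans ?_ (lintegral_liminf_le' fun n =>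
      ((hfm.mul (hφc n).continuous.measurable.aemeasurable).pow_const 2).ennreal_ofReal)
    refine lintegral_mono_ae ?_
    filter_upwards [hq] with z hz
    have h1 : Tendsto (fun n => ENNReal.ofReal ((f z * φ n z) ^ 2)) atTop
        (𝓝 (ENNReal.ofReal (f z ^ 2))) := by
      refine tendsto_const_nhds.congr' ?_
      filter_upwards [hz.eventually (lt_mem_nhds (by norm_num : (3 / 4 : ℝ) < 1))] with n hn
      simp only [hφ, quotientCutoff]
      rw [smoothStep_of_ge hn.le, mul_one]
    exact h1.liminf_eq.ge
  -- An intermediate level suffices: along the sequence the masses eventually exceed `b` by Fatou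
  -- and the energies fall below $\xi b$. No upper bound for $\int f^2$ is needed.
  obtain ⟨b, hb0, hb⟩ := exists_between hpos2
  have hev1 := eventually_lt_of_lt_liminf (hb.trans_le hmass)
  have hev2 := hE.eventually (gt_mem_nhds
    (ENNReal.mul_pos (ENNReal.ofReal_pos.mpr hξ).ne' hb0.ne'))
  obtain ⟨n, hn1, hn2⟩ := (hev1.and hev2).exists
  have hK := (hg n).2.1
  have hzero : ∀ z ∉ tsupport (g n), φ n z = 0 := fun z hz =>
    image_eq_zero_of_notMem_tsupport fun h => hz (hφs n h)
  have hzero' : ∀ z ∉ tsupport (g n), gradSq (φ n) z = 0 := fun z hz =>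
    gradSq_eq_zero_of_notMem fun h => hz (hφs n h)
  -- Nothing is known about `f` outside $\Omega$; the compact support inside $\Omega$ makes the
  -- products globally continuous.
  have hcont : ∀ h : ℂ → ℝ, ContinuousOn h Ω → (∀ z ∉ tsupport (g n), h z = 0) →
      Continuous h := by
    intro h hh h0
    refine ContinuousOn.continuous_of_tsupport_subset hh hΩ (subset_trans ?_ (hg n).2.2)
    exact closure_minimal (fun z hz => by by_contra hc; exact hz (h0 z hc)) (isClosed_tsupport _)
  have hgφ : Continuous (gradSq (φ n)) := by
    rw [← continuousOn_univ]
    exact continuousOn_gradSq fun z _ => ((hφc n).of_le one_le_two).contDiffAt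
  have i1 : Integrable fun z => (f z * φ n z) ^ 2 :=
    integrable_of_continuous_of_tsupport hK
      (hcont _ ((hfc.mul (hφc n).continuous.continuousOn).pow 2)
        (fun z hz => by simp [hzero z hz])) (fun z hz => by simp [hzero z hz])
  have i2 : Integrable fun z => f z ^ 2 * gradSq (φ n) z :=
    integrable_of_continuous_of_tsupport hK
      (hcont _ ((hfc.pow 2).mul hgφ.continuousOn)
        (fun z hz => by simp [hzero' z hz])) (fun z hz => by simp [hzero' z hz])
  have hset : ∀ h : ℂ → ℝ, (∀ z ∉ tsupport (g n), h z = 0) →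
      ∫⁻ z in Ω, ENNReal.ofReal (h z) = ∫⁻ z, ENNReal.ofReal (h z) := by
    intro h h0
    refine setLIntegral_eq_of_support_subset fun z hz => ?_
    by_contra hc
    exact hz (by simp [h0 z fun h => hc ((hg n).2.2 h)])
  rw [hset _ fun z hz => by simp [hzero z hz], ← ofReal_integral_eq_lintegral_ofReal i1
    (Eventually.of_forall fun z => sq_nonneg _)] at hn1
  rw [hset _ fun z hz => by simp [hzero' z hz], ← ofReal_integral_eq_lintegral_ofReal i2
    (Eventually.of_forall fun z => mul_nonneg (sq_nonneg _) (gradSq_nonneg _ _))] at hn2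
  have hM : 0 < ∫ z, (f z * φ n z) ^ 2 := ENNReal.ofReal_pos.mp (hb0.trans hn1)
  refine ⟨φ n, hφc n, ?_, (hφs n).trans (hg n).2.2, hM, ?_⟩
  · exact hK.of_isClosed_subset (isClosed_tsupport _) (hφs n)
  · rw [← ENNReal.ofReal_le_ofReal_iff (by positivity), ENNReal.ofReal_mul hξ.le]
    exact hn2.le.trans (by gcongr)

/-! ### The form on products of the ground state with a cut-off -/

lemma integral_fderiv_eq_zero {h : ℂ → ℝ} (hh : ContDiff ℝ 1 h) (hc : HasCompactSupport h)
    (v : ℂ) : ∫ z, fderiv ℝ h z v = 0 := by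
  have hd : Integrable fun z => fderiv ℝ h z v :=
    ((hh.continuous_fderiv one_ne_zero).clm_apply continuous_const).integrable_of_hasCompactSupport
      ((hc.fderiv (𝕜 := ℝ)).comp_left (g := fun L : ℂ →L[ℝ] ℝ => L v) (by simp))
  have := integral_mul_fderiv_eq_neg_fderiv_mul_of_integrable (μ := volume)
    (f := fun _ : ℂ => (1 : ℝ)) (g := h) (v := v) (by simp) (by simpa using hd)
    (by simpa using hh.continuous.integrable_of_hasCompactSupport hc)
    (fun _ _ => differentiableAt_const _)
    (fun x _ => (hh.differentiable one_ne_zero).differentiableAt)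
  simpa using this

lemma angDeriv_eq {F : Type*} [NormedAddCommGroup F] [NormedSpace ℝ F] (h : ℂ → F) (z : ℂ) :
    angDeriv h z = z.re • fderiv ℝ h z Complex.I - z.im • fderiv ℝ h z 1 := by
  have : Complex.I * z = z.re • Complex.I - z.im • (1 : ℂ) := by
    apply Complex.ext <;> simp
  rw [angDeriv, this, map_sub, map_smul, map_smul]

/-- The rotation field is divergence free: each of its two coefficients is a linear function that is
constant in the direction in which it differentiates, so integration by parts leaves nothing. -/
lemma integral_angDeriv_eq_zero {h : ℂ → ℝ} (hh : ContDiff ℝ 1 h) (hc : HasCompactSupport h) :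
    ∫ z, angDeriv h z = 0 := by
  have hL : ∀ (L : ℂ →L[ℝ] ℝ) (v : ℂ), L v = 0 →
      Integrable (fun z => L z * fderiv ℝ h z v) ∧ ∫ z, L z * fderiv ℝ h z v = 0 := by
    intro L v hLv
    have hd : Integrable fun z => L z * fderiv ℝ h z v :=
      (L.continuous.mul ((hh.continuous_fderiv one_ne_zero).clm_apply
        continuous_const)).integrable_of_hasCompactSupport
        (((hc.fderiv (𝕜 := ℝ)).comp_left (g := fun L : ℂ →L[ℝ] ℝ => L v) (by simp)).mul_left)
    refine ⟨hd, ?_⟩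
    have := integral_mul_fderiv_eq_neg_fderiv_mul_of_integrable (μ := volume)
      (f := L) (g := h) (v := v) (by simp [hLv]) hd
      ((L.continuous.mul hh.continuous).integrable_of_hasCompactSupport hc.mul_left)
      (fun _ _ => L.differentiableAt)
      (fun x _ => (hh.differentiable one_ne_zero).differentiableAt)
    simpa [hLv] using this
  obtain ⟨i1, e1⟩ := hL Complex.reCLM Complex.I (by simp)
  obtain ⟨i2, e2⟩ := hL Complex.imCLM 1 (by simp)
  have : ∀ z, angDeriv h z = Complex.reCLM z * fderiv ℝ h z Complex.I
      - Complex.imCLM z * fderiv ℝ h z 1 := fun z => by simp [angDeriv_eq]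
  simp only [this]
  rw [integral_sub i1 i2, e1, e2, sub_zero]

lemma angDeriv_sq_le (h : ℂ → ℝ) (z : ℂ) : angDeriv h z ^ 2 ≤ ‖z‖ ^ 2 * gradSq h z := by
  rw [angDeriv_eq, gradSq_real, ← Complex.normSq_eq_norm_sq, Complex.normSq_apply, smul_eq_mul,
    smul_eq_mul]
  nlinarith [sq_nonneg (z.re * fderiv ℝ h z 1 + z.im * fderiv ℝ h z Complex.I)]

/-- The integrand of the form `⟨u, H(s) u⟩`. -/
def formDensity {F : Type*} [NormedAddCommGroup F] [NormedSpace ℝ F] (Ω : Set ℂ) (β₀ α : ℝ)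
    (f : ℂ → ℝ) (m dm : ℝ) (u : ℂ → F) (z : ℂ) : ℝ :=
  gradSq u z + β₀ ^ 2 * ‖angDeriv u z‖ ^ 2
    + (potential β₀ α f m dm z - specBottom Ω β₀) * ‖u z‖ ^ 2

lemma formDensity_eq_zero_of_notMem {Ω : Set ℂ} {β₀ α : ℝ} {f : ℂ → ℝ} {m dm : ℝ} {u : ℂ → ℝ}
    {z : ℂ} (hz : z ∉ tsupport u) : formDensity Ω β₀ α f m dm u z = 0 := by
  simp [formDensity, gradSq_eq_zero_of_notMem hz, angDeriv_eq_zero_of_notMem hz,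
    image_eq_zero_of_notMem_tsupport hz]

lemma laplacian_eq_fderiv {f : ℂ → ℝ} {z : ℂ} (hf : ContDiffAt ℝ 2 f z) :
    Laplacian.laplacian f z = fderiv ℝ (fun w => fderiv ℝ f w 1) z 1
      + fderiv ℝ (fun w => fderiv ℝ f w Complex.I) z Complex.I := by
  have hd : DifferentiableAt ℝ (fderiv ℝ f) z :=
    (hf.fderiv_right (m := 1) (by norm_num)).differentiableAt one_ne_zero
  have key : ∀ v : ℂ, fderiv ℝ (fun w => fderiv ℝ f w v) z = (fderiv ℝ (fderiv ℝ f) z).flip v := by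
    intro v
    ext w
    rw [fderiv_clm_apply hd (differentiableAt_const v)]
    simp
  rw [InnerProductSpace.laplacian_eq_iteratedFDeriv_complexPlane, key, key]
  simp [iteratedFDeriv_two_apply]

/-- The divergence terms in the ground state representation. -/
def divergenceTerm (β₀ α : ℝ) (f : ℂ → ℝ) (m dm : ℝ) (φ : ℂ → ℝ) (z : ℂ) : ℝ :=
  fderiv ℝ (fun y => f y * φ y ^ 2 * fderiv ℝ f y 1) z 1
    + fderiv ℝ (fun y => f y * φ y ^ 2 * fderiv ℝ f y Complex.I) z Complex.I
    + (β₀ ^ 2 + m * (2 * β₀ - m) * (1 / α ^ 2)) *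
        angDeriv (fun y => f y * φ y ^ 2 * angDeriv f y) z
    - dm * (1 / α ^ 2) / 2 * angDeriv (fun y => (f y * φ y) ^ 2) z

lemma contDiffAt_angDeriv {f : ℂ → ℝ} {z : ℂ} (hf : ContDiffAt ℝ 2 f z) :
    ContDiffAt ℝ 1 (angDeriv f) z := by
  unfold angDeriv
  exact (hf.fderiv_right (m := 1) (by norm_num)).clm_apply (by fun_prop)

/-- The ground state representation. Writing $u=f\varphi$, the key identity is
$f\varphi^2\partial_\alpha^2f=\partial_\alpha(f\varphi^2\partial_\alpha f)-(\partial_\alpha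
u)^2+(f\partial_\alpha\varphi)^2$, which produces the negative term; likewise
$u\varphi\,\partial_\alpha f=\frac12\partial_\alpha(u^2)-u f\partial_\alpha\varphi$. -/
lemma formDensity_mul_cutoff {Ω : Set ℂ} {β₀ α : ℝ} {f : ℂ → ℝ} (hf : IsGroundState Ω β₀ f)
    (m dm : ℝ) {φ : ℂ → ℝ} {z : ℂ} (hφ : DifferentiableAt ℝ φ z) (hz : z ∈ Ω) :
    formDensity Ω β₀ α f m dm (fun y => f y * φ y) z =
      f z ^ 2 * gradSq φ z
        + (β₀ ^ 2 + m * (2 * β₀ - m) * (1 / α ^ 2)) * (f z * angDeriv φ z) ^ 2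
        + dm * (1 / α ^ 2) * ((f z * φ z) * (f z * angDeriv φ z))
        - m * (2 * β₀ - m) * (1 / α ^ 2) * angDeriv (fun y => f y * φ y) z ^ 2
        + divergenceTerm β₀ α f m dm φ z := by
  have hf2 := hf.contDiffAt z hz
  have hp := hf.pos z hz
  have hfd : HasFDerivAt f (fderiv ℝ f z) z := (hf2.differentiableAt two_ne_zero).hasFDerivAt
  have hφd := hφ.hasFDerivAt
  have hud := hfd.mul hφd
  have hdd : DifferentiableAt ℝ (fderiv ℝ f) z :=
    (hf2.fderiv_right (m := 1) (by norm_num)).differentiableAt one_ne_zero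
  have hw : ∀ (g : ℂ → ℝ) (v : ℂ), DifferentiableAt ℝ g z →
      fderiv ℝ (fun y => f y * φ y ^ 2 * g y) z v =
        (fderiv ℝ f z v * φ z ^ 2 + 2 * f z * φ z * fderiv ℝ φ z v) * g z
          + f z * φ z ^ 2 * fderiv ℝ g z v := by
    intro g v hg
    have := ((hfd.mul (hφd.mul hφd)).mul hg.hasFDerivAt).fderiv
    rw [show (fun y => f y * φ y ^ 2 * g y) = f * (φ * φ) * g by
      ext y; simp [pow_two], this]
    simp
    ring
  have hu : ∀ v : ℂ, fderiv ℝ (fun y => f y * φ y) z v =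
      f z * fderiv ℝ φ z v + fderiv ℝ f z v * φ z := by
    intro v
    rw [show (fun y => f y * φ y) = f * φ from rfl, hud.fderiv]
    simp
    ring
  have hu2 : ∀ v : ℂ, fderiv ℝ (fun y => (f y * φ y) ^ 2) z v =
      2 * (f z * φ z) * (f z * fderiv ℝ φ z v + fderiv ℝ f z v * φ z) := by
    intro v
    rw [show (fun y => (f y * φ y) ^ 2) = f * φ * (f * φ) by ext y; simp [pow_two],
      (hud.mul hud).fderiv]
    simp
    ring
  have hv : ∀ v : ℂ, DifferentiableAt ℝ (fun y => fderiv ℝ f y v) z := fun v =>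
    hdd.clm_apply (differentiableAt_const v)
  have hA : DifferentiableAt ℝ (angDeriv f) z :=
    (contDiffAt_angDeriv hf2).differentiableAt one_ne_zero
  have heig := hf.eigen z hz
  rw [laplacian_eq_fderiv hf2] at heig
  have hE : specBottom Ω β₀ = (-(fderiv ℝ (fun w => fderiv ℝ f w 1) z 1
      + fderiv ℝ (fun w => fderiv ℝ f w Complex.I) z Complex.I)
      - β₀ ^ 2 * angDeriv (angDeriv f) z) / f z := by
    rw [heig]; field_simp
  have a1 : angDeriv (fun y => f y * φ y) z = f z * angDeriv φ z + angDeriv f z * φ z := hu _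
  have a2 : angDeriv (fun y => (f y * φ y) ^ 2) z =
      2 * (f z * φ z) * (f z * angDeriv φ z + angDeriv f z * φ z) := hu2 _
  have a3 : angDeriv (fun y => f y * φ y ^ 2 * angDeriv f y) z =
      (angDeriv f z * φ z ^ 2 + 2 * f z * φ z * angDeriv φ z) * angDeriv f z
          + f z * φ z ^ 2 * angDeriv (angDeriv f) z := hw _ _ hA
  simp only [formDensity, divergenceTerm, potential, gradSq_real, Real.norm_eq_abs, sq_abs, hE,
    a1, a2, a3, hu, hw _ _ (hv 1), hw _ _ (hv Complex.I)]
  generalize 1 / α ^ 2 = a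
  field_simp
  ring

lemma integral_divergenceTerm {Ω : Set ℂ} {β₀ α : ℝ} {f : ℂ → ℝ}
    (hf : ∀ z ∈ Ω, ContDiffAt ℝ 2 f z) (m dm : ℝ) {φ : ℂ → ℝ} (hφ : ContDiff ℝ 2 φ)
    (hc : HasCompactSupport φ) (hs : tsupport φ ⊆ Ω) :
    Integrable (divergenceTerm β₀ α f m dm φ) ∧ ∫ z, divergenceTerm β₀ α f m dm φ z = 0 := by
  have hfd : ∀ z ∈ Ω, ∀ v : ℂ, ContDiffAt ℝ 1 (fun y => fderiv ℝ f y v) z := fun z hz v =>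
    ((hf z hz).fderiv_right (m := 1) (by norm_num)).clm_apply contDiffAt_const
  have hf1 : ∀ z ∈ Ω, ContDiffAt ℝ 1 f z := fun z hz => (hf z hz).of_le one_le_two
  have hφ1 : ContDiff ℝ 1 φ := hφ.of_le one_le_two
  have hC : ∀ h : ℂ → ℝ, (∀ z, φ z = 0 → h z = 0) → (∀ z ∈ Ω, ContDiffAt ℝ 1 h z) →
      ContDiff ℝ 1 h ∧ HasCompactSupport h := by
    intro h h0 h1
    have hsub : tsupport h ⊆ tsupport φ := closure_mono fun z hz hz' => hz (h0 z hz')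
    exact ⟨contDiff_of_forall_mem_tsupport fun z hz => h1 z (hs (hsub hz)),
      hc.of_isClosed_subset (isClosed_tsupport _) hsub⟩
  have c1 : ∀ g : ℂ → ℝ, (∀ z ∈ Ω, ContDiffAt ℝ 1 g z) →
      ContDiff ℝ 1 (fun y => f y * φ y ^ 2 * g y) ∧
        HasCompactSupport (fun y => f y * φ y ^ 2 * g y) := fun g hg =>
    hC _ (fun z hz => by simp [hz])
      (fun z hz => ((hf1 z hz).mul (hφ1.contDiffAt.pow 2)).mul (hg z hz))
  have c2 : ContDiff ℝ 1 (fun y => (f y * φ y) ^ 2) ∧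
      HasCompactSupport (fun y => (f y * φ y) ^ 2) :=
    hC _ (fun z hz => by simp [hz]) (fun z hz => ((hf1 z hz).mul hφ1.contDiffAt).pow 2)
  have iD : ∀ h : ℂ → ℝ, ContDiff ℝ 1 h ∧ HasCompactSupport h → ∀ v : ℂ,
      Integrable fun z => fderiv ℝ h z v := fun h hh v =>
    ((hh.1.continuous_fderiv one_ne_zero).clm_apply
      continuous_const).integrable_of_hasCompactSupport
      ((hh.2.fderiv (𝕜 := ℝ)).comp_left (g := fun L : ℂ →L[ℝ] ℝ => L v) (by simp))
  have iA : ∀ h : ℂ → ℝ, ContDiff ℝ 1 h ∧ HasCompactSupport h → Integrable (angDeriv h) :=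
    fun h hh => integrable_of_continuous_of_tsupport hh.2 (continuous_angDeriv hh.1)
      fun z hz => angDeriv_eq_zero_of_notMem hz
  have t1 := c1 _ fun z hz => hfd z hz 1
  have t2 := c1 _ fun z hz => hfd z hz Complex.I
  have t3 := c1 _ fun z hz => contDiffAt_angDeriv (hf z hz)
  have j1 := iD _ t1 1
  have j2 := iD _ t2 Complex.I
  have j3 := (iA _ t3).const_mul (β₀ ^ 2 + m * (2 * β₀ - m) * (1 / α ^ 2))
  have j4 := (iA _ c2).const_mul (dm * (1 / α ^ 2) / 2)
  refine ⟨((j1.fun_add j2).fun_add j3).sub j4, ?_⟩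
  unfold divergenceTerm
  rw [integral_sub ((j1.fun_add j2).fun_add j3) j4, integral_add (j1.fun_add j2) j3, integral_add j1 j2,
    integral_const_mul, integral_const_mul, integral_fderiv_eq_zero t1.1 t1.2,
    integral_fderiv_eq_zero t2.1 t2.2, integral_angDeriv_eq_zero t3.1 t3.2,
    integral_angDeriv_eq_zero c2.1 c2.2]
  ring

lemma continuousOn_potential {Ω : Set ℂ} {β₀ α : ℝ} {f : ℂ → ℝ}
    (hf : ∀ z ∈ Ω, ContDiffAt ℝ 2 f z) (hpos : ∀ z ∈ Ω, 0 < f z) (m dm : ℝ) :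
    ContinuousOn (potential β₀ α f m dm) Ω := by
  intro z hz
  refine ContinuousAt.continuousWithinAt ?_
  have h1 := contDiffAt_angDeriv (hf z hz)
  have h2 : ContinuousAt (angDeriv (angDeriv f)) z := by
    unfold angDeriv
    exact (h1.fderiv_right (m := 0) (by norm_num)).continuousAt.clm_apply (by fun_prop)
  have h3 := (hf z hz).continuousAt
  have h4 := h1.continuousAt
  have h0 := (hpos z hz).ne'
  unfold potential
  exact continuousAt_const.mul ((continuousAt_const.mul (h4.div h3 h0)).sub
    (continuousAt_const.mul (h2.div h3 h0)))

lemma integrable_formDensity {Ω : Set ℂ} (hΩ : IsOpen Ω) {β₀ α : ℝ} {f : ℂ → ℝ}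
    (hf : ∀ z ∈ Ω, ContDiffAt ℝ 2 f z) (hpos : ∀ z ∈ Ω, 0 < f z) (m dm : ℝ) {u : ℂ → ℝ}
    (hu : ContDiff ℝ 1 u) (hc : HasCompactSupport u) (hs : tsupport u ⊆ Ω) :
    Integrable (formDensity Ω β₀ α f m dm u) := by
  refine integrable_of_continuous_of_tsupport hc ?_ fun z hz => formDensity_eq_zero_of_notMem hz
  refine ContinuousOn.continuous_of_tsupport_subset ?_ hΩ (subset_trans ?_ hs)
  · have h1 := continuousOn_gradSq (Ω := Ω) fun z _ => hu.contDiffAt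
    have h2 := (continuous_angDeriv hu).continuousOn (s := Ω)
    have h3 := hu.continuous.continuousOn (s := Ω)
    have h4 := continuousOn_potential (β₀ := β₀) (α := α) hf hpos m dm
    unfold formDensity
    fun_prop
  · refine closure_minimal (fun z hz => ?_) (isClosed_tsupport _)
    by_contra h
    exact hz (formDensity_eq_zero_of_notMem h)

/-- After integration the divergences drop out, and everything except $-M\int(\partial_\alpha u)^2$
is at most $\eta\int u^2$. The $\dot\mu$-term costs half of $\eta$ by Young, and the cut-off energy
costs the other half. -/
lemma exists_trial_function {Ω : Set ℂ} (hΩ : IsOpen Ω) (hne : Ω.Nonempty) {d : ℝ}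
    (hd : ∀ z ∈ Ω, ‖z‖ ≤ d) {K : ℝ}
    (hK : ∀ u : ℂ → ℝ, ContDiff ℝ 1 u → HasCompactSupport u → tsupport u ⊆ Ω →
      K * ∫ z, u z ^ 2 ≤ ∫ z, angDeriv u z ^ 2)
    {β₀ α : ℝ} {f : ℂ → ℝ} (hf : IsGroundState Ω β₀ f) {m : ℝ} (dm : ℝ)
    (hm : 0 ≤ m * (2 * β₀ - m)) {η : ℝ} (hη : 0 < η) :
    ∃ u : ℂ → ℝ, ContDiff ℝ 1 u ∧ HasCompactSupport u ∧ tsupport u ⊆ Ω ∧ 0 < ∫ z, u z ^ 2 ∧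
      ∫ z, formDensity Ω β₀ α f m dm u z ≤
        (η - K * (m * (2 * β₀ - m)) * (1 / α ^ 2)) * ∫ z, u z ^ 2 := by
  set M := m * (2 * β₀ - m) * (1 / α ^ 2) with hM
  have hM0 : 0 ≤ M := by positivity
  set b := dm * (1 / α ^ 2) with hb
  -- Collects all coefficients of $f^2|\nabla\varphi|^2$, using $(\partial_\alpha\varphi)^2\le
  -- d^2|\nabla\varphi|^2$ on $\Omega$; the cut-off is then chosen with $\xi=\eta/(2C)$.
  set C := 1 + (β₀ ^ 2 + M + b ^ 2 / (2 * η)) * d ^ 2 with hC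
  have hC0 : 0 < C := by positivity
  obtain ⟨φ, hφ, hφc, hφs, hmass, hen⟩ :=
    exists_cutoff hΩ hne hf.contDiffAt hf.pos hf.memH10 (ξ := η / 2 / C) (by positivity)
  set u : ℂ → ℝ := fun y => f y * φ y with hu
  have hus : tsupport u ⊆ tsupport φ :=
    closure_mono fun z hz hz' => hz (by simp only [hu, hz', mul_zero])
  have hu1 : ContDiff ℝ 1 u := contDiff_of_forall_mem_tsupport fun z hz =>
    ((hf.contDiffAt z (hφs (hus hz))).of_le one_le_two).mul (hφ.of_le one_le_two).contDiffAt
  have huc : HasCompactSupport u := hφc.of_isClosed_subset (isClosed_tsupport _) hus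
  obtain ⟨iD, hD⟩ := integral_divergenceTerm (β₀ := β₀) (α := α) hf.contDiffAt m dm hφ hφc hφs
  have iu : Integrable fun z => u z ^ 2 := integrable_of_continuous_of_tsupport huc
    (hu1.continuous.pow 2) fun z hz => by simp [image_eq_zero_of_notMem_tsupport hz]
  have iA : Integrable fun z => angDeriv u z ^ 2 := integrable_of_continuous_of_tsupport huc
    ((continuous_angDeriv hu1).pow 2) fun z hz => by simp [angDeriv_eq_zero_of_notMem hz]
  have iG : Integrable fun z => f z ^ 2 * gradSq φ z := by
    refine integrable_of_continuous_of_tsupport hφc ?_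
      fun z hz => by simp [gradSq_eq_zero_of_notMem hz]
    refine ContinuousOn.continuous_of_tsupport_subset ?_ hΩ (subset_trans ?_ hφs)
    · refine ContinuousOn.mul (fun z hz => ?_)
        (continuousOn_gradSq fun z _ => (hφ.of_le one_le_two).contDiffAt)
      exact ((hf.contDiffAt z hz).continuousAt.pow 2).continuousWithinAt
    · refine closure_minimal (fun z hz => ?_) (isClosed_tsupport _)
      by_contra h
      exact hz (by simp [gradSq_eq_zero_of_notMem h])
  refine ⟨u, hu1, huc, hus.trans hφs, hmass, ?_⟩
  have hpt : ∀ z, formDensity Ω β₀ α f m dm u z ≤ C * (f z ^ 2 * gradSq φ z) + η / 2 * u z ^ 2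
      - M * angDeriv u z ^ 2 + divergenceTerm β₀ α f m dm φ z := by
    intro z
    by_cases hz : z ∈ tsupport φ
    · have hzΩ := hφs hz
      rw [formDensity_mul_cutoff hf m dm (hφ.differentiable two_ne_zero).differentiableAt hzΩ,
        ← hM, ← hb]
      have h1 : (f z * angDeriv φ z) ^ 2 ≤ d ^ 2 * (f z ^ 2 * gradSq φ z) := by
        rw [mul_pow]
        have h2 := angDeriv_sq_le φ z
        have h3 : ‖z‖ ^ 2 ≤ d ^ 2 := pow_le_pow_left₀ (norm_nonneg _) (hd z hzΩ) 2
        calc f z ^ 2 * angDeriv φ z ^ 2 ≤ f z ^ 2 * (d ^ 2 * gradSq φ z) := by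
              have := gradSq_nonneg φ z
              gcongr
              exact h2.trans (by gcongr)
          _ = d ^ 2 * (f z ^ 2 * gradSq φ z) := by ring
      have h4 : b * (u z * (f z * angDeriv φ z)) ≤
          η / 2 * u z ^ 2 + b ^ 2 / (2 * η) * (f z * angDeriv φ z) ^ 2 := by
        have : 0 ≤ (η * u z - b * (f z * angDeriv φ z)) ^ 2 / (2 * η) := by positivity
        have e : (η * u z - b * (f z * angDeriv φ z)) ^ 2 / (2 * η) =
            η / 2 * u z ^ 2 + b ^ 2 / (2 * η) * (f z * angDeriv φ z) ^ 2
              - b * (u z * (f z * angDeriv φ z)) := by field_simp; ring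
        linarith
      have h5 : (β₀ ^ 2 + M + b ^ 2 / (2 * η)) * (f z * angDeriv φ z) ^ 2 ≤
          (β₀ ^ 2 + M + b ^ 2 / (2 * η)) * (d ^ 2 * (f z ^ 2 * gradSq φ z)) := by gcongr
      have h6 : C * (f z ^ 2 * gradSq φ z) = f z ^ 2 * gradSq φ z +
          (β₀ ^ 2 + M + b ^ 2 / (2 * η)) * (d ^ 2 * (f z ^ 2 * gradSq φ z)) := by
        rw [hC]; ring
      change _ + b * (u z * (f z * angDeriv φ z)) - M * angDeriv u z ^ 2 + _ ≤ _
      linarith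
    · have hzero : ∀ h : ℂ → ℝ, tsupport h ⊆ tsupport φ → ∀ v, fderiv ℝ h z v = 0 := by
        intro h hh v
        rw [image_eq_zero_of_notMem_tsupport fun h' => hz (hh (tsupport_fderiv_subset ℝ h'))]
        rfl
      have hsub : ∀ h : ℂ → ℝ, (∀ y, φ y = 0 → h y = 0) → tsupport h ⊆ tsupport φ :=
        fun h h0 => closure_mono fun y hy hy' => hy (h0 y hy')
      rw [formDensity_eq_zero_of_notMem fun h => hz (hus h), gradSq_eq_zero_of_notMem hz,
        angDeriv_eq_zero_of_notMem fun h => hz (hus h),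
        image_eq_zero_of_notMem_tsupport fun h => hz (hus h)]
      simp only [divergenceTerm, angDeriv]
      rw [hzero _ (hsub _ fun y hy => by simp [hy]), hzero _ (hsub _ fun y hy => by simp [hy]),
        hzero _ (hsub _ fun y hy => by simp [hy]), hzero _ (hsub _ fun y hy => by simp [hy])]
      simp
  have i3 : Integrable fun z => C * (f z ^ 2 * gradSq φ z) + η / 2 * u z ^ 2
      - M * angDeriv u z ^ 2 :=
    ((iG.const_mul C).fun_add (iu.const_mul (η / 2))).sub (iA.const_mul M)
  have iR := i3.fun_add iD
  have hle : ∫ z, formDensity Ω β₀ α f m dm u z ≤ C * (∫ z, f z ^ 2 * gradSq φ z)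
      + η / 2 * (∫ z, u z ^ 2) - M * ∫ z, angDeriv u z ^ 2 := by
    have hR : ∫ z, (C * (f z ^ 2 * gradSq φ z) + η / 2 * u z ^ 2 - M * angDeriv u z ^ 2
        + divergenceTerm β₀ α f m dm φ z) = C * (∫ z, f z ^ 2 * gradSq φ z)
        + η / 2 * (∫ z, u z ^ 2) - M * ∫ z, angDeriv u z ^ 2 := by
      rw [integral_add i3 iD,
        integral_sub ((iG.const_mul C).fun_add (iu.const_mul (η / 2))) (iA.const_mul M),
        integral_add (iG.const_mul C) (iu.const_mul (η / 2)), hD, integral_const_mul,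
        integral_const_mul, integral_const_mul, add_zero]
    rw [← hR]
    exact integral_mono (integrable_formDensity hΩ hf.contDiffAt hf.pos m dm hu1 huc
      (hus.trans hφs)) iR hpt
  have hP := mul_le_mul_of_nonneg_left (hK u hu1 huc (hus.trans hφs)) hM0
  have hen' : C * (∫ z, f z ^ 2 * gradSq φ z) ≤ η / 2 * ∫ z, u z ^ 2 := by
    have := mul_le_mul_of_nonneg_left hen hC0.le
    rwa [← mul_assoc, mul_div_cancel₀ _ hC0.ne'] at this
  have e : K * (m * (2 * β₀ - m)) * (1 / α ^ 2) = M * K := by rw [hM]; ring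
  rw [e]
  linarith

/-! ### Smooth approximation of trial functions -/

/-- Mollification, with derivatives falling on `u`. The compact set is fixed before the accuracy, so
that in `exists_smooth_trial` the potential, possibly unbounded near the boundary, is bounded
uniformly along the approximation. -/
lemma exists_smooth_approx {Ω : Set ℂ} (hΩ : IsOpen Ω) {u : ℂ → ℝ} (hu : ContDiff ℝ 1 u)
    (hc : HasCompactSupport u) (hs : tsupport u ⊆ Ω) :
    ∃ K ⊆ Ω, IsCompact K ∧ ∀ e : ℝ, 0 < e → ∃ v : ℂ → ℝ, ContDiff ℝ (⊤ : ℕ∞) v ∧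
      tsupport v ⊆ K ∧ ∀ z, |v z - u z| ≤ e ∧ ‖fderiv ℝ v z - fderiv ℝ u z‖ ≤ e := by
  obtain ⟨δ₀, hδ₀, hK⟩ := hc.exists_cthickening_subset_open hΩ hs
  refine ⟨Metric.cthickening δ₀ (tsupport u), hK, IsCompact.cthickening hc, fun e he => ?_⟩
  have hdc : Continuous (fderiv ℝ u) := hu.continuous_fderiv one_ne_zero
  obtain ⟨δ₁, hδ₁, h1⟩ := Metric.uniformContinuous_iff.mp
    (hu.continuous.uniformContinuous_of_tendsto_cocompact hc.is_zero_at_infty) e he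
  obtain ⟨δ₂, hδ₂, h2⟩ := Metric.uniformContinuous_iff.mp
    (hdc.uniformContinuous_of_tendsto_cocompact (hc.fderiv (𝕜 := ℝ)).is_zero_at_infty) e he
  set δ := min δ₀ (min δ₁ δ₂) with hδ
  have hδ0 : 0 < δ := by positivity
  let b : ContDiffBump (0 : ℂ) := ⟨δ / 2, δ, by positivity, by linarith⟩
  have hbi : LocallyIntegrable (b.normed volume) :=
    (b.continuous_normed).locallyIntegrable
  refine ⟨convolution (b.normed volume) u (ContinuousLinearMap.lsmul ℝ ℝ) volume, ?_, ?_,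
    fun z => ⟨?_, ?_⟩⟩
  · exact b.hasCompactSupport_normed.contDiff_convolution_left _ b.contDiff_normed
      hu.continuous.locallyIntegrable
  · refine closure_minimal ?_ (Metric.isClosed_cthickening)
    refine (support_convolution_subset _).trans ?_
    rw [b.support_normed_eq]
    rintro _ ⟨x, hx, y, hy, rfl⟩
    refine Metric.mem_cthickening_of_dist_le _ y _ _ (subset_tsupport _ hy) ?_
    have : ‖x‖ < δ := by simpa using hx
    simp only [dist_eq_norm, add_sub_cancel_right]
    exact this.le.trans (min_le_left _ _)
  · rw [← Real.dist_eq]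
    refine b.dist_normed_convolution_le hu.continuous.aestronglyMeasurable fun x hx => ?_
    refine (h1 (lt_of_lt_of_le hx ?_)).le
    exact (min_le_right _ _).trans (min_le_left _ _)
  · have hd := hc.hasFDerivAt_convolution_right (ContinuousLinearMap.lsmul ℝ ℝ) hbi hu z
    rw [hd.fderiv]
    have he : convolution (b.normed volume) (fderiv ℝ u)
        ((ContinuousLinearMap.lsmul ℝ ℝ).precompR ℂ) volume z =
        convolution (b.normed volume) (fderiv ℝ u) (ContinuousLinearMap.lsmul ℝ ℝ) volume z := by
      rw [convolution, convolution]
      congr 1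
    rw [he, ← dist_eq_norm]
    refine b.dist_normed_convolution_le hdc.aestronglyMeasurable fun x hx => ?_
    refine (h2 (lt_of_lt_of_le hx ?_)).le
    exact (min_le_right _ _).trans (min_le_right _ _)

lemma gradSq_le (u : ℂ → ℝ) (z : ℂ) : gradSq u z ≤ 2 * ‖fderiv ℝ u z‖ ^ 2 := by
  have h1 := (fderiv ℝ u z).le_opNorm 1
  have h2 := (fderiv ℝ u z).le_opNorm Complex.I
  simp only [norm_one, Complex.norm_I, mul_one] at h1 h2
  have h3 := pow_le_pow_left₀ (norm_nonneg _) h1 2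
  have h4 := pow_le_pow_left₀ (norm_nonneg _) h2 2
  unfold gradSq
  linarith

lemma exists_smooth_trial {Ω : Set ℂ} (hΩ : IsOpen Ω) {β₀ α : ℝ} {f : ℂ → ℝ}
    (hf : ∀ z ∈ Ω, ContDiffAt ℝ 2 f z) (hpos : ∀ z ∈ Ω, 0 < f z) {m dm : ℝ} {u : ℂ → ℝ}
    (hu : ContDiff ℝ 1 u) (hc : HasCompactSupport u) (hs : tsupport u ⊆ Ω)
    (hmass : 0 < ∫ z, u z ^ 2) {q : ℝ}
    (hq : ∫ z, formDensity Ω β₀ α f m dm u z < q * ∫ z, u z ^ 2) :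
    ∃ v : ℂ → ℝ, IsTest Ω v ∧ 0 < ∫ z, v z ^ 2 ∧
      ∫ z, formDensity Ω β₀ α f m dm v z < q * ∫ z, v z ^ 2 := by
  obtain ⟨K, hKΩ, hK, happ⟩ := exists_smooth_approx hΩ hu hc hs
  choose v hv hvK hvu using fun n : ℕ => happ (1 / ((n : ℝ) + 1)) (by positivity)
  have hone : ∀ n : ℕ, 1 / ((n : ℝ) + 1) ≤ 1 := fun n => by
    rw [div_le_one (by positivity)]
    linarith [(Nat.cast_nonneg n : (0 : ℝ) ≤ n)]
  have hlim : ∀ z, Tendsto (fun n => v n z) atTop (𝓝 (u z)) := fun z =>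
    tendsto_iff_norm_sub_tendsto_zero.mpr (squeeze_zero (fun _ => norm_nonneg _)
      (fun n => (hvu n z).1) tendsto_one_div_add_atTop_nhds_zero_nat)
  have hlimd : ∀ z, Tendsto (fun n => fderiv ℝ (v n) z) atTop (𝓝 (fderiv ℝ u z)) := fun z =>
    tendsto_iff_norm_sub_tendsto_zero.mpr (squeeze_zero (fun _ => norm_nonneg _)
      (fun n => (hvu n z).2) tendsto_one_div_add_atTop_nhds_zero_nat)
  have hv1 : ∀ n, ContDiff ℝ 1 (v n) := fun n => (hv n).of_le (by exact_mod_cast le_top)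
  have hvc : ∀ n, HasCompactSupport (v n) := fun n =>
    hK.of_isClosed_subset (isClosed_tsupport _) (hvK n)
  have hvs : ∀ n, tsupport (v n) ⊆ Ω := fun n => (hvK n).trans hKΩ
  obtain ⟨B₁, hB₁⟩ := hu.continuous.bounded_above_of_compact_support hc
  obtain ⟨B₂, hB₂⟩ := (hu.continuous_fderiv one_ne_zero).bounded_above_of_compact_support
    (hc.fderiv (𝕜 := ℝ))
  obtain ⟨B₃, hB₃⟩ := hK.exists_bound_of_continuousOn
    ((continuousOn_potential (β₀ := β₀) (α := α) hf hpos m dm).mono hKΩ)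
  obtain ⟨B₄, hB₄⟩ := hK.exists_bound_of_continuousOn continuousOn_id
  simp only [id] at hB₄
  have hvB : ∀ n z, |v n z| ≤ B₁ + 1 := fun n z => by
    have h1 := (hvu n z).1.trans (hone n)
    have h2 := hB₁ z
    rw [Real.norm_eq_abs] at h2
    linarith [abs_sub_abs_le_abs_sub (v n z) (u z)]
  have hdB : ∀ n z, ‖fderiv ℝ (v n) z‖ ≤ B₂ + 1 := fun n z => by
    have h1 := (hvu n z).2.trans (hone n)
    linarith [norm_sub_norm_le (fderiv ℝ (v n) z) (fderiv ℝ u z), hB₂ z]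
  have hindicator : ∀ C : ℝ, Integrable (K.indicator fun _ => C) := fun C =>
    (integrableOn_const hK.measure_lt_top.ne).integrable_indicator hK.measurableSet
  have hT1 : Tendsto (fun n => ∫ z, v n z ^ 2) atTop (𝓝 (∫ z, u z ^ 2)) := by
    refine tendsto_integral_of_dominated_convergence (K.indicator fun _ => (B₁ + 1) ^ 2)
      (fun n => ((hv n).continuous.pow 2).aestronglyMeasurable) (hindicator _)
      (fun n => Eventually.of_forall fun z => ?_)
      (Eventually.of_forall fun z => (hlim z).pow 2)
    by_cases hz : z ∈ K
    · rw [indicator_of_mem hz, Real.norm_eq_abs, abs_pow]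
      exact pow_le_pow_left₀ (abs_nonneg _) (hvB n z) 2
    · rw [indicator_of_notMem hz, image_eq_zero_of_notMem_tsupport fun h => hz (hvK n h)]
      simp
  have hT2 : Tendsto (fun n => ∫ z, formDensity Ω β₀ α f m dm (v n) z) atTop
      (𝓝 (∫ z, formDensity Ω β₀ α f m dm u z)) := by
    refine tendsto_integral_of_dominated_convergence (K.indicator fun _ =>
        2 * (B₂ + 1) ^ 2 + β₀ ^ 2 * (B₄ ^ 2 * (2 * (B₂ + 1) ^ 2))
          + (B₃ + |specBottom Ω β₀|) * (B₁ + 1) ^ 2)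
      (fun n => (integrable_formDensity hΩ hf hpos m dm (hv1 n) (hvc n)
        (hvs n)).aestronglyMeasurable) (hindicator _)
      (fun n => Eventually.of_forall fun z => ?_)
      (Eventually.of_forall fun z => ?_)
    · by_cases hz : z ∈ K
      · rw [indicator_of_mem hz]
        have g0 := gradSq_nonneg (v n) z
        have g1 : gradSq (v n) z ≤ 2 * (B₂ + 1) ^ 2 := (gradSq_le _ _).trans (by
          have := pow_le_pow_left₀ (norm_nonneg _) (hdB n z) 2
          linarith)
        have g2 : ‖angDeriv (v n) z‖ ^ 2 ≤ B₄ ^ 2 * (2 * (B₂ + 1) ^ 2) := by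
          rw [Real.norm_eq_abs, sq_abs]
          refine (angDeriv_sq_le _ _).trans ?_
          have := pow_le_pow_left₀ (norm_nonneg _) (hB₄ z hz) 2
          gcongr
        have g3 : ‖v n z‖ ^ 2 ≤ (B₁ + 1) ^ 2 := pow_le_pow_left₀ (norm_nonneg _) (hvB n z) 2
        have g4 : |potential β₀ α f m dm z - specBottom Ω β₀| ≤ B₃ + |specBottom Ω β₀| :=
          (abs_sub _ _).trans (by have := hB₃ z hz; rw [Real.norm_eq_abs] at this; linarith)
        rw [formDensity, Real.norm_eq_abs]
        refine (abs_add_le _ _).trans (add_le_add ((abs_add_le _ _).trans (add_le_add ?_ ?_)) ?_)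
        · rwa [abs_of_nonneg g0]
        · rw [abs_of_nonneg (by positivity)]
          gcongr
        · rw [abs_mul, abs_of_nonneg (by positivity : (0 : ℝ) ≤ ‖v n z‖ ^ 2)]
          gcongr
          exact (abs_nonneg _).trans g4
      · rw [indicator_of_notMem hz, formDensity_eq_zero_of_notMem fun h => hz (hvK n h)]
        simp
    · have hL : ∀ w : ℂ, Tendsto (fun n => fderiv ℝ (v n) z w) atTop (𝓝 (fderiv ℝ u z w)) :=
        fun w => ((ContinuousLinearMap.apply ℝ ℝ w).continuous.tendsto _).comp (hlimd z)
      unfold formDensity gradSq angDeriv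
      exact ((((hL _).norm.pow 2).add ((hL _).norm.pow 2)).add
        (((hL _).norm.pow 2).const_mul _)).add (((hlim z).norm.pow 2).const_mul _)
  have hev1 := hT1.eventually (lt_mem_nhds hmass)
  have hev2 := (hT2.sub (hT1.const_mul q)).eventually (gt_mem_nhds (sub_neg.mpr hq))
  obtain ⟨n, hn1, hn2⟩ := (hev1.and hev2).exists
  exact ⟨v n, ⟨hv n, hvc n, hvs n⟩, hn1, sub_neg.mp hn2⟩

lemma fderiv_ofReal_smul {v : ℂ → ℝ} (hv : Differentiable ℝ v) (t : ℝ) (z w : ℂ) :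
    fderiv ℝ (fun y => ((t * v y : ℝ) : ℂ)) z w = ((t * fderiv ℝ v z w : ℝ) : ℂ) := by
  have h : HasFDerivAt (fun y => ((t * v y : ℝ) : ℂ))
      (Complex.ofRealCLM.comp (t • fderiv ℝ v z)) z :=
    Complex.ofRealCLM.hasFDerivAt.comp z ((hv z).hasFDerivAt.const_mul t)
  rw [h.fderiv]
  simp

lemma formDensity_ofReal_smul {Ω : Set ℂ} {β₀ α : ℝ} {f : ℂ → ℝ} {m dm : ℝ} {v : ℂ → ℝ}
    (hv : Differentiable ℝ v) (t : ℝ) (z : ℂ) :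
    formDensity Ω β₀ α f m dm (fun y => ((t * v y : ℝ) : ℂ)) z =
      t ^ 2 * formDensity Ω β₀ α f m dm v z := by
  simp only [formDensity, gradSq, angDeriv, fderiv_ofReal_smul hv, Complex.norm_real,
    Real.norm_eq_abs, sq_abs]
  ring

lemma groundEigenvalue_le {Ω : Set ℂ} (hΩ : IsOpen Ω) (hne : Ω.Nonempty) {d : ℝ}
    (hd : ∀ z ∈ Ω, ‖z‖ ≤ d) {K : ℝ}
    (hK : ∀ u : ℂ → ℝ, ContDiff ℝ 1 u → HasCompactSupport u → tsupport u ⊆ Ω →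
      K * ∫ z, u z ^ 2 ≤ ∫ z, angDeriv u z ^ 2)
    {β₀ α : ℝ} {f : ℂ → ℝ} (hf : IsGroundState Ω β₀ f) {m : ℝ} (dm : ℝ)
    (hm : 0 ≤ m * (2 * β₀ - m)) :
    groundEigenvalue Ω β₀ α f m dm ≤ ((-(K * (m * (2 * β₀ - m) / α ^ 2)) : ℝ) : EReal) := by
  refine EReal.le_of_forall_lt_iff_le.mp fun q hq => ?_
  rw [EReal.coe_lt_coe_iff] at hq
  -- Half of the gap between `q` and the bound is spent on $\eta$; the other half leaves a strict
  -- inequality that survives mollification.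
  obtain ⟨u, hu, hc, hs, hmass, hle⟩ := exists_trial_function hΩ hne hd hK (α := α) hf dm hm
    (η := (q + K * (m * (2 * β₀ - m) / α ^ 2)) / 2) (by linarith)
  obtain ⟨v, hv, hvmass, hvq⟩ := exists_smooth_trial (q := q) hΩ hf.contDiffAt hf.pos hu hc hs hmass
    (hle.trans_lt (mul_lt_mul_of_pos_right (by
      have : K * (m * (2 * β₀ - m)) * (1 / α ^ 2) = K * (m * (2 * β₀ - m) / α ^ 2) := by ring
      rw [this]; linarith) hmass))
  have hvd : Differentiable ℝ v := hv.1.differentiable (by simp)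
  set I := ∫ z, v z ^ 2 with hI
  set t := (Real.sqrt I)⁻¹ with ht
  have ht2 : t ^ 2 * I = 1 := by
    rw [ht, inv_pow, Real.sq_sqrt hvmass.le, inv_mul_cancel₀ hvmass.ne']
  set U : ℂ → ℂ := fun y => ((t * v y : ℝ) : ℂ) with hU
  have hUs : tsupport U ⊆ tsupport v :=
    closure_mono fun z hz hz' => hz (by simp [hU, hz'])
  have hUtest : U ∈ testSpace Ω :=
    ⟨Complex.ofRealCLM.contDiff.comp (contDiff_const.mul hv.1),
      hv.2.1.of_isClosed_subset (isClosed_tsupport _) hUs, hUs.trans hv.2.2⟩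
  have hnorm : ∫ z in Ω, ‖U z‖ ^ 2 = 1 := by
    rw [setIntegral_eq_integral_of_forall_compl_eq_zero, ← ht2, hI, ← integral_const_mul]
    · congr 1
      ext z
      simp only [hU, Complex.norm_real, Real.norm_eq_abs, sq_abs]
      ring
    · intro z hz
      rw [image_eq_zero_of_notMem_tsupport fun h => hz (hv.2.2 (hUs h))]
      simp
  have hform : HForm Ω β₀ α f m dm U = t ^ 2 * ∫ z, formDensity Ω β₀ α f m dm v z := by
    rw [← integral_const_mul]
    simp only [← formDensity_ofReal_smul hvd]
    change ∫ z in Ω, formDensity Ω β₀ α f m dm U z = _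
    rw [setIntegral_eq_integral_of_forall_compl_eq_zero]
    intro z hz
    rw [hU, formDensity_ofReal_smul hvd, formDensity_eq_zero_of_notMem fun h => hz (hv.2.2 h),
      mul_zero]
  refine (iInf₂_le_of_le U hUtest (iInf_le _ hnorm)).trans ?_
  rw [EReal.coe_le_coe_iff, hform]
  have ht0 : 0 < t := inv_pos.mpr (Real.sqrt_pos.mpr hvmass)
  calc t ^ 2 * ∫ z, formDensity Ω β₀ α f m dm v z ≤ t ^ 2 * (q * I) := by gcongr
    _ = q := by rw [mul_left_comm, ht2, mul_one]

/-! ### Minimax values and the Lieb–Thirring constant -/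

lemma HForm_smul {Ω : Set ℂ} {β₀ α : ℝ} {f : ℂ → ℝ} {m dm : ℝ} {u : ℂ → ℂ}
    (hu : Differentiable ℝ u) (a : ℂ) :
    HForm Ω β₀ α f m dm (a • u) = ‖a‖ ^ 2 * HForm Ω β₀ α f m dm u := by
  have h : ∀ z w, fderiv ℝ (a • u) z w = a * fderiv ℝ u z w := by
    intro z w
    rw [fderiv_const_smul (hu z)]
    simp
  rw [HForm, HForm, ← integral_const_mul]
  congr 1
  ext z
  simp only [gradSq, angDeriv, h, norm_mul, Pi.smul_apply, smul_eq_mul]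
  ring

/-- Every normalised test function spans an admissible line, on whose unit vectors the form is
constant. -/
lemma minimaxEigenvalue_zero_le (Ω : Set ℂ) (β₀ α : ℝ) (f : ℂ → ℝ) (m dm : ℝ) :
    minimaxEigenvalue Ω β₀ α f m dm 0 ≤ groundEigenvalue Ω β₀ α f m dm := by
  refine le_iInf₂ fun u hu => le_iInf fun h1 => ?_
  have hu0 : u ≠ 0 := by
    rintro rfl
    simp at h1
  have hud : Differentiable ℝ u := (show IsTest Ω u from hu).1.differentiable (by simp)
  refine iInf_le_of_le (Submodule.span ℂ {u}) (iInf_le_of_le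
    ⟨by simpa [Submodule.span_le] using hu, by simp [finrank_span_singleton hu0]⟩ ?_)
  refine iSup₂_le fun w hw => iSup_le fun hw1 => ?_
  obtain ⟨a, rfl⟩ := Submodule.mem_span_singleton.mp hw
  have ha : ‖a‖ ^ 2 = 1 := by
    simp only [Pi.smul_apply, smul_eq_mul, norm_mul, mul_pow] at hw1
    rwa [integral_const_mul, h1, mul_one] at hw1
  rw [HForm_smul hud, ha, one_mul]

lemma le_traceNegPow {Ω : Set ℂ} {β₀ α : ℝ} {f : ℂ → ℝ} {m dm X p : ℝ} (hp : 0 ≤ p)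
    (h : groundEigenvalue Ω β₀ α f m dm ≤ ((-X : ℝ) : EReal)) :
    ENNReal.ofReal X ^ p ≤ traceNegPow Ω β₀ α f m dm p := by
  refine le_trans ?_ (ENNReal.le_tsum 0)
  refine ENNReal.rpow_le_rpow ?_ hp
  have h1 : (X : EReal) ≤ -(minimaxEigenvalue Ω β₀ α f m dm 0) := by
    rw [EReal.le_neg]
    exact_mod_cast (minimaxEigenvalue_zero_le Ω β₀ α f m dm).trans h
  rw [← EReal.real_coe_toENNReal]
  exact EReal.toENNReal_le_toENNReal h1

/-- Log-convexity of $\Gamma$ gives $\Gamma(\sigma+\frac32)\le\Gamma(\sigma+1)\sqrt{\sigma+1}$,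
which reduces the claim to $4\pi(\sigma+1)\le2.4025^{2\sigma+1}$. At $\sigma=\frac32$ this reads
$10\pi\le2.4025^4$, with $33$ in between; beyond that point exponential growth beats linear growth.
-/
lemma one_le_semiclassicalConst_mul {σ : ℝ} (hσ : 3 / 2 ≤ σ) :
    1 ≤ semiclassicalConst σ * (2.4025 : ℝ) ^ (σ + 1 / 2) := by
  have hG1 : 0 < Real.Gamma (σ + 1) := Real.Gamma_pos_of_pos (by linarith)
  have hG2 : 0 < Real.Gamma (σ + 3 / 2) := Real.Gamma_pos_of_pos (by linarith)
  have hG : Real.Gamma (σ + 3 / 2) ≤ Real.Gamma (σ + 1) * Real.sqrt (σ + 1) := by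
    have h := Real.Gamma_mul_add_mul_le_rpow_Gamma_mul_rpow_Gamma (s := σ + 1) (t := σ + 2)
      (a := 1 / 2) (b := 1 / 2) (by linarith) (by linarith) (by norm_num) (by norm_num)
      (by norm_num)
    rw [show (1 / 2 : ℝ) * (σ + 1) + 1 / 2 * (σ + 2) = σ + 3 / 2 by ring,
      show σ + 2 = (σ + 1) + 1 by ring, Real.Gamma_add_one (by linarith : σ + 1 ≠ 0),
      ← Real.sqrt_eq_rpow, ← Real.sqrt_eq_rpow, Real.sqrt_mul (by linarith), mul_left_comm,
      Real.mul_self_sqrt hG1.le, mul_comm] at h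
    exact h
  have hC : Real.sqrt (4 * Real.pi) * Real.sqrt (σ + 1) ≤ (2.4025 : ℝ) ^ (σ + 1 / 2) := by
    rw [← Real.sqrt_mul (by positivity)]
    apply Real.sqrt_le_iff.mpr
    refine ⟨by positivity, ?_⟩
    have e : ((2.4025 : ℝ) ^ (σ + 1 / 2)) ^ 2 =
        2.4025 ^ 4 * ((2.4025 : ℝ) ^ (2 : ℕ)) ^ (σ - 3 / 2) := by
      rw [← Real.rpow_natCast _ 2, ← Real.rpow_mul (by norm_num), ← Real.rpow_natCast _ 2,
        ← Real.rpow_mul (by norm_num), ← Real.rpow_natCast _ 4, ← Real.rpow_add (by norm_num)]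
      congr 1
      push_cast
      ring
    have hlog : (0.8 : ℝ) ≤ Real.log ((2.4025 : ℝ) ^ (2 : ℕ)) := by
      have := Real.one_sub_inv_le_log_of_pos (show (0 : ℝ) < (2.4025 : ℝ) ^ (2 : ℕ) by norm_num)
      norm_num at this ⊢
      linarith
    have hexp : 1 + (σ - 3 / 2) * 0.8 ≤ ((2.4025 : ℝ) ^ (2 : ℕ)) ^ (σ - 3 / 2) := by
      rw [Real.rpow_def_of_pos (by norm_num)]
      have := Real.add_one_le_exp (Real.log ((2.4025 : ℝ) ^ (2 : ℕ)) * (σ - 3 / 2))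
      nlinarith
    rw [e]
    have hpi := Real.pi_lt_d2
    have h4 : (33 : ℝ) ≤ 2.4025 ^ 4 := by norm_num
    calc 4 * Real.pi * (σ + 1) ≤ 33 * (1 + (σ - 3 / 2) * 0.8) := by nlinarith
      _ ≤ _ := by
        have : 0 ≤ 1 + (σ - 3 / 2) * 0.8 := by nlinarith
        gcongr
  rw [semiclassicalConst, div_mul_eq_mul_div, one_le_div (by positivity)]
  calc Real.sqrt (4 * Real.pi) * Real.Gamma (σ + 3 / 2)
      ≤ Real.sqrt (4 * Real.pi) * (Real.Gamma (σ + 1) * Real.sqrt (σ + 1)) := by gcongr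
    _ = Real.Gamma (σ + 1) * (Real.sqrt (4 * Real.pi) * Real.sqrt (σ + 1)) := by ring
    _ ≤ _ := by gcongr

/-! ### The ground-state eigenvalue on the ribbons -/

/-- The choice $\kappa=3.1/(2\delta_k)$ satisfies the strict condition $2\delta_k\kappa<\pi$ and
retains the surplus factor $2.4025$. -/
lemma groundEigenvalue_ribbon_le {ε : ℝ} (hε : 0 < ε) (hε1 : ε < 1) {k : ℕ} {β₀ α : ℝ}
    {f : ℂ → ℝ} (hf : IsGroundState (ribbon ε k) β₀ f) {m : ℝ} (dm : ℝ)
    (hm : 0 ≤ m * (2 * β₀ - m)) :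
    groundEigenvalue (ribbon ε k) β₀ α f m dm ≤
      ((-(2.4025 * (4 ^ (k + 1) / Real.pi ^ 2) * (m * (2 * β₀ - m) / α ^ 2)) : ℝ) : EReal) := by
  have hδ := halfStep_pos k
  have hK : (3.1 / (2 * halfStep k)) ^ 2 = 2.4025 * (4 ^ (k + 1) / Real.pi ^ 2) := by
    have h4 : (4 : ℝ) ^ (k + 1) = (2 ^ (k + 1)) ^ 2 := by
      rw [← pow_mul, mul_comm, pow_mul]; norm_num
    rw [h4, halfStep]
    have := Real.pi_pos
    field_simp
    norm_num
  rw [← hK]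
  refine groundEigenvalue_le (isOpen_ribbon hε1 k) (isConnected_ribbon hε hε1 k).nonempty
    (fun z hz => (norm_lt_of_mem_ribbon hz).le) (fun u hu hc hs => ?_) hf dm hm
  refine poincare_ribbon hε1 hu hc hs (by positivity) ?_
  rw [div_mul_cancel₀ _ (by positivity)]
  linarith [Real.pi_gt_d2]

lemma le_liebThirringRHS {ε : ℝ} (hε : 0 < ε) (hε1 : ε < 1) {k : ℕ} {β₀ α : ℝ} (hα : 0 < α)
    {f : ℂ → ℝ} (hf : IsGroundState (ribbon ε k) β₀ f) {μ : ℝ → ℝ} (dμ : ℝ → ℝ)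
    (hμ0 : ∀ s, 0 ≤ μ s) (hμ1 : ∀ s, 0 ≤ 2 * β₀ - μ s) {σ : ℝ} (hσ : 3 / 2 ≤ σ) :
    ENNReal.ofReal (1 / α * (4 ^ (k + 1) / Real.pi ^ 2) ^ (σ + 1 / 2)) *
        (∫⁻ s : ℝ, ENNReal.ofReal (μ s ^ (σ + 1 / 2) * (2 * β₀ - μ s) ^ (σ + 1 / 2))) ≤
      liebThirringRHS (ribbon ε k) β₀ α f μ dμ σ := by
  have hp : 0 ≤ σ + 1 / 2 := by linarith
  rw [liebThirringRHS, ← lintegral_const_mul' _ _ ENNReal.ofReal_ne_top,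
    ← lintegral_const_mul' _ _ ENNReal.ofReal_ne_top]
  refine lintegral_mono fun s => ?_
  have hm := mul_nonneg (hμ0 s) (hμ1 s)
  have htr := le_traceNegPow hp (groundEigenvalue_ribbon_le (α := α) hε hε1 hf (dμ s) hm)
  refine le_trans ?_ (mul_le_mul_right htr _)
  have hT : 0 < (4 : ℝ) ^ (k + 1) / Real.pi ^ 2 := by positivity
  set T := (4 : ℝ) ^ (k + 1) / Real.pi ^ 2
  have hL : 0 ≤ α ^ (2 * σ) * semiclassicalConst σ := by
    have h1 : 0 < Real.Gamma (σ + 1) := Real.Gamma_pos_of_pos (by linarith)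
    have h2 : 0 < Real.Gamma (σ + 3 / 2) := Real.Gamma_pos_of_pos (by linarith)
    unfold semiclassicalConst
    positivity
  rw [ENNReal.ofReal_rpow_of_nonneg (by positivity) hp, ← ENNReal.ofReal_mul (by positivity),
    ← ENNReal.ofReal_mul hL]
  apply ENNReal.ofReal_le_ofReal
  -- The prefactor cancels against the powers of $\alpha$ in the eigenvalue bound, up to one factor
  -- $1/\alpha$.
  have hαp : α ^ (2 * σ) / (α ^ 2) ^ (σ + 1 / 2) = 1 / α := by
    rw [← Real.rpow_natCast, ← Real.rpow_mul hα.le, ← Real.rpow_sub hα,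
      show 2 * σ - ((2 : ℕ) : ℝ) * (σ + 1 / 2) = -1 by push_cast; ring, Real.rpow_neg_one, one_div]
  rw [Real.mul_rpow (by positivity) (by positivity), Real.mul_rpow (by norm_num) hT.le,
    Real.div_rpow hm (by positivity), Real.mul_rpow (hμ0 s) (hμ1 s)]
  have key := one_le_semiclassicalConst_mul hσ
  have h0 : 0 ≤ 1 / α * T ^ (σ + 1 / 2) *
      (μ s ^ (σ + 1 / 2) * (2 * β₀ - μ s) ^ (σ + 1 / 2)) := by
    have := Real.rpow_nonneg (hμ0 s) (σ + 1 / 2)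
    have := Real.rpow_nonneg (hμ1 s) (σ + 1 / 2)
    positivity
  calc _ ≤ 1 / α * T ^ (σ + 1 / 2) * (μ s ^ (σ + 1 / 2) * (2 * β₀ - μ s) ^ (σ + 1 / 2)) *
        (semiclassicalConst σ * (2.4025 : ℝ) ^ (σ + 1 / 2)) := le_mul_of_one_le_right h0 key
    _ = _ := by rw [← hαp]; ring

lemma continuous_integral_Iic {g : ℝ → ℝ} (hg : Integrable g) :
    Continuous fun s => ∫ x in Iic s, g x := by
  have : (fun s => ∫ x in Iic s, g x) = fun s => (∫ x in Iic 0, g x) + ∫ x in (0 : ℝ)..s, g x := by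
    ext s
    rw [← intervalIntegral.integral_Iic_sub_Iic hg.integrableOn hg.integrableOn]
    ring
  rw [this]
  exact continuous_const.add (intervalIntegral.continuous_primitive
    (fun _ _ => hg.intervalIntegrable) 0)

end FoldedRibbon

end

theorem mainTheorem4
    (ε : ℝ) (hε : 0 < ε) (hε1 : ε < 1)
    (β₀ : ℝ) (hβ₀ : 0 < β₀)
    (μ dμ : ℝ → ℝ) (hμ : ∀ s, 0 ≤ μ s)
    (s₀ : ℝ) (hs₀ : 0 < s₀) (hsupp : Function.support μ ⊆ Set.Icc (-s₀) s₀)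
    (hdμ : Integrable dμ) (hμdμ : ∀ s, μ s = ∫ x in Set.Iic s, dμ x)
    (c : ℝ) (hc : 0 < c)
    (hcγ : ∀ k : ℕ, 1 ≤ k → c < 1 / 3 * FoldedRibbon.gammaConst β₀ (FoldedRibbon.ribbon ε k))
    (hμc : ∃ M : ℝ, M < c * β₀ ∧ ∀ s, |μ s| ≤ M)
    (f : ℕ → ℂ → ℝ)
    (hf : ∀ k : ℕ, 1 ≤ k → FoldedRibbon.IsGroundState (FoldedRibbon.ribbon ε k) β₀ (f k)) :
    (∀ k : ℕ, 1 ≤ k →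
      FoldedRibbon.IsTubeCrossSection (FoldedRibbon.ribbon ε k) ∧
      FoldedRibbon.crossRadius (FoldedRibbon.ribbon ε k) = 2 ∧
      Metric.ediam (FoldedRibbon.ribbon ε k) ≤ 4 ∧
      volume (FoldedRibbon.ribbon ε k) ≤ ENNReal.ofReal (4 * Real.pi)) ∧
    (∀ k : ℕ, 1 ≤ k → ∀ s : ℝ,
      FoldedRibbon.groundEigenvalue (FoldedRibbon.ribbon ε k) β₀
          (FoldedRibbon.alphaConst β₀ c (FoldedRibbon.ribbon ε k)) (f k) (μ s) (dμ s) ≤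
        ((-(4 ^ (k + 1) / Real.pi ^ 2 * (μ s * (2 * β₀ - μ s) /
          FoldedRibbon.alphaConst β₀ c (FoldedRibbon.ribbon ε k) ^ 2)) : ℝ) : EReal) ∧
      (0 < μ s →
        FoldedRibbon.groundEigenvalue (FoldedRibbon.ribbon ε k) β₀
            (FoldedRibbon.alphaConst β₀ c (FoldedRibbon.ribbon ε k)) (f k) (μ s) (dμ s) <
          ((-(4 ^ (k + 1) / Real.pi ^ 2 * (μ s * (2 * β₀ - μ s) /
            FoldedRibbon.alphaConst β₀ c (FoldedRibbon.ribbon ε k) ^ 2)) : ℝ) : EReal))) ∧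
    (∀ σ : ℝ, 3 / 2 ≤ σ →
      (∀ k : ℕ, 1 ≤ k →
        ENNReal.ofReal (1 / FoldedRibbon.alphaConst β₀ c (FoldedRibbon.ribbon ε k) *
              (4 ^ (k + 1) / Real.pi ^ 2) ^ (σ + 1 / 2)) *
            (∫⁻ s : ℝ, ENNReal.ofReal (μ s ^ (σ + 1 / 2) * (2 * β₀ - μ s) ^ (σ + 1 / 2))) ≤
          FoldedRibbon.liebThirringRHS (FoldedRibbon.ribbon ε k) β₀
            (FoldedRibbon.alphaConst β₀ c (FoldedRibbon.ribbon ε k)) (f k) μ dμ σ) ∧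
      ((∃ s, μ s ≠ 0) →
        Tendsto (fun k : ℕ => FoldedRibbon.liebThirringRHS (FoldedRibbon.ribbon ε k) β₀
          (FoldedRibbon.alphaConst β₀ c (FoldedRibbon.ribbon ε k)) (f k) μ dμ σ) atTop (𝓝 ⊤))) := by
  have hγ : ∀ k : ℕ, FoldedRibbon.gammaConst β₀ (FoldedRibbon.ribbon ε k) ≤ 1 / 3 :=
    fun k => min_le_left _ _
  have hα : ∀ k : ℕ, 1 ≤ k → 0 < FoldedRibbon.alphaConst β₀ c (FoldedRibbon.ribbon ε k) :=
    fun k hk => Real.sqrt_pos.mpr (by linarith [hcγ k hk])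
  -- All ribbons have radius $2$, so the prefactor $1/\alpha$ cannot spoil the divergence in $k$.
  have hα1 : ∀ k : ℕ, FoldedRibbon.alphaConst β₀ c (FoldedRibbon.ribbon ε k) =
      FoldedRibbon.alphaConst β₀ c (FoldedRibbon.ribbon ε 1) := fun k => by
    simp only [FoldedRibbon.alphaConst, FoldedRibbon.gammaConst,
      FoldedRibbon.crossRadius_ribbon hε hε1]
  -- Since $c<\gamma/3\le1/9$, the bound $\mu<c\beta_0$ lies far below $2\beta_0$.
  have hμ1 : ∀ s, 0 < 2 * β₀ - μ s := by
    intro s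
    obtain ⟨M, hM, hMs⟩ := hμc
    have h1 := (le_abs_self _).trans (hMs s)
    have h2 := hcγ 1 le_rfl
    have h3 := hγ 1
    nlinarith
  refine ⟨fun k _ => ⟨FoldedRibbon.isTubeCrossSection_ribbon hε hε1 k,
    FoldedRibbon.crossRadius_ribbon hε hε1 k, FoldedRibbon.ediam_ribbon_le ε k,
    FoldedRibbon.volume_ribbon_le ε k⟩, fun k hk s => ?_, fun σ hσ => ?_⟩
  · have h := FoldedRibbon.groundEigenvalue_ribbon_le
      (α := FoldedRibbon.alphaConst β₀ c (FoldedRibbon.ribbon ε k)) hε hε1 (hf k hk) (dμ s)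
      (mul_nonneg (hμ s) (hμ1 s).le)
    have hαk := hα k hk
    have hm := hμ1 s
    have hT : 0 < (4 : ℝ) ^ (k + 1) / Real.pi ^ 2 := by positivity
    -- The surplus $1.4025\,Tx$ is nonnegative, and positive as soon as $\mu(s)>0$.
    have hsplit : ∀ T x : ℝ, -(2.4025 * T * x) = -(T * x) - 1.4025 * (T * x) := fun T x => by ring
    refine ⟨h.trans ?_, fun hs => h.trans_lt ?_⟩
    · have hμs := hμ s
      rw [EReal.coe_le_coe_iff, hsplit, sub_le_self_iff]
      positivity
    · rw [EReal.coe_lt_coe_iff, hsplit, sub_lt_self_iff]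
      positivity
  · have hle := fun (k : ℕ) (hk : 1 ≤ k) => FoldedRibbon.le_liebThirringRHS hε hε1 (hα k hk)
      (hf k hk) dμ hμ (fun s => (hμ1 s).le) hσ
    refine ⟨hle, fun ⟨s₁, hs₁⟩ => ?_⟩
    have hcont : Continuous μ := by
      rw [show μ = fun s => ∫ x in Set.Iic s, dμ x from funext hμdμ]
      exact FoldedRibbon.continuous_integral_Iic hdμ
    have hp : 0 < σ + 1 / 2 := by linarith
    -- By continuity $\mu$ is positive on a nonempty open set, so the integral is nonzero; being
    -- possibly infinite does no harm to the limit.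
    have hJ : (∫⁻ s : ℝ, ENNReal.ofReal (μ s ^ (σ + 1 / 2) * (2 * β₀ - μ s) ^ (σ + 1 / 2))) ≠ 0 := by
      refine ((lintegral_pos_iff_support (by fun_prop)).mpr ?_).ne'
      refine (IsOpen.measure_pos volume (isOpen_lt continuous_const hcont)
        ⟨s₁, lt_of_le_of_ne (hμ s₁) hs₁.symm⟩).trans_le (measure_mono fun s hs => ?_)
      have h1 : 0 < μ s := hs
      have h2 := hμ1 s
      simp only [Function.mem_support, ne_eq, ENNReal.ofReal_eq_zero, not_le]
      positivity
    have hpow : Tendsto (fun k : ℕ => (4 : ℝ) ^ (k + 1) / Real.pi ^ 2) atTop atTop :=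
      ((tendsto_pow_atTop_atTop_of_one_lt (by norm_num)).comp
        (tendsto_add_atTop_nat 1)).atTop_div_const (by positivity)
    have hα0 := hα 1 le_rfl
    have hT := ENNReal.Tendsto.mul_const
      (b := ∫⁻ s : ℝ, ENNReal.ofReal (μ s ^ (σ + 1 / 2) * (2 * β₀ - μ s) ^ (σ + 1 / 2)))
      (ENNReal.tendsto_ofReal_atTop.comp (((tendsto_rpow_atTop hp).comp hpow).const_mul_atTop
        (one_div_pos.mpr hα0))) (Or.inl ENNReal.top_ne_zero)
    rw [ENNReal.top_mul hJ] at hT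
    refine tendsto_nhds_top_mono hT ?_
    filter_upwards [eventually_ge_atTop 1] with k hk
    have := hle k hk
    rw [hα1 k] at this ⊢
    exact this
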